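/- Let $k \ge 3$ be an integer, let $p$ be a real number with $1 \le p < k$, and let $b \in \{0,1\}$. Let $C_b : \{0,1\}^k \to \{0,1\}$ be the parity constraint with $C_b(x) = 1$ if and only if $x_1 \oplus \cdots \oplus x_k = b$. For $\varepsilon \ge 0$, a matrix $V \in \mathbb{R}^{d \times k}$ of full column rank and a vector $t \in \mathbb{R}^d$ define a $(p,k,C_b,\varepsilon)$-isolating parallelepiped if $\|Vx - t\|_p = 1$ for all $x \in \{0,1\}^k$ with $C_b(x) = 1$, and $\|Vx - t\|_p = 1 + \varepsilon$ for all $x \in \{0,1\}^k$ with $C_b(x) = 0$. They define a $(p,k,C_b,\varepsilon)$-isolating lattice if moreover $\|Vx - t\|_p \ge 1 + \varepsilon$ for all $x \in \mathbb{Z}^k \setminus \{0,1\}^k$. Put $$\delta_{k,p} := \frac{|\sin(\pi p/2)|}{p^2}\Big(\frac{2p}{e^2\pi^2 k}\Big)^{(p+1)/2}.$$ (1) Let $\eta := \lfloor k/2 \rfloor + \lfloor p/2 \rfloor$, $t^* := (1 + (-1)^{k+1})/2$ and, for $u \in \{-1,1\}^k$, $\alpha_u := 1 + (-1)^{\eta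 + b} \prod_{i=1}^k u_i$. Let $W \in \mathbb{R}^{2^k \times k}$ be the matrix whose row indexed by $u \in \{-1,1\}^k$ is $\alpha_u^{1/p} u^T$, and let $w \in \mathbb{R}^{2^k}$ be the vector whose coordinate indexed by $u$ is $t^* \alpha_u^{1/p}$. Let $V' := -2W$ and $t' := w - W\mathbf{1}$, so that $V'z - t' = W(\mathbf{1} - 2z) - w$ for every $z$ (the change from $\{-1,1\}$ to $\{0,1\}$ coordinates). Then there are $c > 0$ and $\varepsilon \ge \delta_{k,p}$ such that $cV'$ and $ct'$ define a $(p,k,C_b,\varepsilon)$-isolating parallelepiped; if $p$ is a computable real number, then all entries of $cV'$ and $ct'$ are computable real numbers. (2) There is a $(p,k,C_b,\varepsilon)$-isolating lattice for some $$\varepsilon \ge \delta_{k,p} \cdot \frac{1}{1 + 2k/(3^p - 1)} \ge \frac{\delta_{k,p}}{2k},$$ and it can be chosen with computable entries if $p$ is computable. -/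

import Mathlib

open scoped Matrix

noncomputable section

/-- The `ℓ_p` norm of a real vector with finitely many coordinates, `1 ≤ p ≤ ∞`. -/
def lpNorm {ι : Type*} [Fintype ι] (p : ENNReal) (v : ι → ℝ) : ℝ :=
  ‖(WithLp.toLp p v : PiLp p (fun _ : ι => ℝ))‖

/-- The 0-1 vector in `ℝ^k` of a Boolean assignment. -/
def boolVec {k : ℕ} (x : Fin k → Bool) : Fin k → ℝ := fun i => if x i then 1 else 0

/-- The vector in `ℝ^k` of an integer vector. -/
def intVec {k : ℕ} (x : Fin k → ℤ) : Fin k → ℝ := fun i => (x i : ℝ)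

/-- The `k`-Parity constraint `C_b`, which asks that `x_1 ⊕ ⋯ ⊕ x_k = b`. -/
def parityConstraint (k : ℕ) (b : Bool) (x : Fin k → Bool) : Bool :=
  (List.ofFn x).foldr xor false == b

/-- `V` (with full column rank) and `t` define a `(p, k, C, ε)`-isolating parallelepiped. -/
structure IsIsolatingParallelepiped {ι : Type*} [Fintype ι] {k : ℕ} (p : ENNReal)
    (C : (Fin k → Bool) → Bool) (ε : ℝ) (V : Matrix ι (Fin k) ℝ) (t : ι → ℝ) : Prop where
  eps_nonneg : 0 ≤ ε
  full_rank : V.rank = k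
  sat : ∀ x : Fin k → Bool, C x = true → lpNorm p (V *ᵥ boolVec x - t) = 1
  unsat : ∀ x : Fin k → Bool, C x = false → lpNorm p (V *ᵥ boolVec x - t) = 1 + ε

/-- `V` (with full column rank) and `t` define a `(p, k, C, ε)`-isolating lattice: in addition,
integer vectors with a coordinate outside `{0, 1}` are mapped at distance at least `1 + ε`. -/
structure IsIsolatingLattice {ι : Type*} [Fintype ι] {k : ℕ} (p : ENNReal)
    (C : (Fin k → Bool) → Bool) (ε : ℝ) (V : Matrix ι (Fin k) ℝ) (t : ι → ℝ) : Prop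
    extends IsIsolatingParallelepiped p C ε V t where
  nonbool : ∀ x : Fin k → ℤ, (∃ i, x i ≠ 0 ∧ x i ≠ 1) → 1 + ε ≤ lpNorm p (V *ᵥ intVec x - t)

/-- The matrix `V(α)` whose row indexed by `u ∈ {-1, 1}^k` is `α_u^{1/p} • u`. -/
def paramMatrix {k : ℕ} (p : ℝ) (α : (Fin k → ℤˣ) → ℝ) : Matrix (Fin k → ℤˣ) (Fin k) ℝ :=
  Matrix.of fun u i => α u ^ (1 / p) * (((u i : ℤˣ) : ℤ) : ℝ)

/-- The vector `t(α, s)` whose coordinate indexed by `u ∈ {-1, 1}^k` is `s * α_u^{1/p}`. -/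
def paramTarget {k : ℕ} (p : ℝ) (α : (Fin k → ℤˣ) → ℝ) (s : ℝ) : (Fin k → ℤˣ) → ℝ :=
  fun u => s * α u ^ (1 / p)

/-- The weights `α_u = 1 + (-1)^{η + b} ∏ u_i`, where `η = ⌊k/2⌋ + ⌊p/2⌋`. -/
def parityWeight (k : ℕ) (p : ℝ) (b : Bool) (u : Fin k → ℤˣ) : ℝ :=
  1 + (-1) ^ ((k / 2 + ⌊p / 2⌋₊) + b.toNat) * ∏ i, (((u i : ℤˣ) : ℤ) : ℝ)

/-- The number `(1 + (-1)^{k+1}) / 2`. -/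
def parityShift (k : ℕ) : ℝ := (1 + (-1) ^ (k + 1)) / 2

/-- The matrix obtained from `V` by the change from `{-1, 1}` to `{0, 1}` coordinates,
`y = 1 - 2 z`. -/
def toBoolMatrix {ι : Type*} {k : ℕ} (V : Matrix ι (Fin k) ℝ) : Matrix ι (Fin k) ℝ :=
  (-2 : ℝ) • V

/-- The target obtained from `t` by the change from `{-1, 1}` to `{0, 1}` coordinates,
`y = 1 - 2 z`. -/
def toBoolTarget {ι : Type*} {k : ℕ} (V : Matrix ι (Fin k) ℝ) (t : ι → ℝ) : ι → ℝ :=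
  t - V *ᵥ 1

theorem toBool_spec {ι : Type*} {k : ℕ} (V : Matrix ι (Fin k) ℝ) (t : ι → ℝ) (z : Fin k → ℝ) :
    toBoolMatrix V *ᵥ z - toBoolTarget V t = V *ᵥ (1 - (2 : ℝ) • z) - t := by
  have h : ((-2 : ℝ) • V) *ᵥ z = -(2 : ℝ) • V *ᵥ z := Matrix.smul_mulVec _ _ _
  rw [toBoolMatrix, toBoolTarget, h, Matrix.mulVec_sub, Matrix.mulVec_smul, neg_smul]
  abel

/-- Computable real numbers: dyadic approximations to within `2^{-n}` can be computed from `n`. -/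
def IsComputableReal (x : ℝ) : Prop :=
  ∃ f : ℕ → ℤ, Computable f ∧ ∀ n : ℕ, |x - (f n : ℝ) / 2 ^ n| ≤ 1 / 2 ^ n

/-- All the entries of `V` and `t` are computable real numbers. -/
def HasComputableEntries {ι : Type*} {k : ℕ} (V : Matrix ι (Fin k) ℝ) (t : ι → ℝ) : Prop :=
  (∀ i j, IsComputableReal (V i j)) ∧ ∀ i, IsComputableReal (t i)

/-- The quantity `|sin(π p / 2)| / p^2 * (2 p / (e^2 π^2 k))^{(p + 1) / 2}`. -/
def parityGap (k : ℕ) (p : ℝ) : ℝ :=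
  |Real.sin (Real.pi * p / 2)| / p ^ 2 *
    (2 * p / (Real.exp 1 ^ 2 * Real.pi ^ 2 * k)) ^ ((p + 1) / 2)

end

/-! Multiplying each row `u` by the sign vector of a Boolean assignment permutes the cube, so the
`p`-th power of the distance to the target depends only on the parity of the assignment. Up to
scaling it is one of two half-moments: the sum of `|∑ u_i - t*| ^ p` over the `u` with a prescribed
coordinate product. Write `S` for the half-moment of the satisfying parity and `U` for the other.
With `A` the full absolute moment and `D` the signed one, `2S = A - D` and `2U = A + D`, hence `U /
S ≥ exp (2D / A)`. Everything reduces to `p δ A ≤ 2D`.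

Lower bound on `D` (`le_sum_mul_abs_rpow`, `le_cubeSignedMoment`): `|x| ^ p` is an integral over `t`
of `x ^ (2N) * x ^ 2 / (t + x ^ 2)` with `N = ⌊p/2⌋` and positive weight. Polynomial division leaves
a polynomial of degree at most `2N < k` in `x`, which the signed sum over the cube kills, plus `(-t)
^ (N + 1) / (t + x ^ 2)`. The latter is a Laplace transform of cosines, and the signed sum of
cosines is a constant times an even power of the sine. So the integrand has a constant sign, and
concentration of the sine power near `π/2` bounds it.

Upper bound on `A` (`sum_abs_cubeForm_rpow_le`): a Chernoff argument with `cosh`.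
`parityGap_numeric` compares the two bounds.

For the lattice, an extra block with rows `2a e_j` and target entries `a` is constant on Boolean
points and large on other integer points. Its relative weight `a / d` is rational, so that all
entries remain integer multiples of a single constant `(∑ N_i ^ p) ^ (-1/p)` with natural `N_i`.
This number is computable when `p` is, by two-sided rational enclosures. -/

/-! ### Integral representation of powers and lower bounds for signed moments -/

open MeasureTheory in
-- The integrand is `t ^ (a - 1) / (t + 1)`; drop `t` from the denominator on `(0, 1]` and `1`
-- beyond. The exact value is `π / sin (π a)`; together with `sin_pi_mul_le` this crude bound loses
-- only a factor 2.
theorem integral_rpowIntegrand₀₁_one_le {a : ℝ} (ha : a ∈ Set.Ioo (0 : ℝ) 1) :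
    ∫ t in Set.Ioi (0 : ℝ), Real.rpowIntegrand₀₁ a t 1 ≤ 1 / (a * (1 - a)) := by
  obtain ⟨h0, h1⟩ := ha
  have hint := Real.integrableOn_rpowIntegrand₀₁_Ioi ⟨h0, h1⟩ zero_le_one
  have hU : Set.Ioi (0 : ℝ) = Set.Ioc 0 1 ∪ Set.Ioi 1 := by simp
  rw [hU, setIntegral_union (Set.Ioc_disjoint_Ioi le_rfl) measurableSet_Ioi
    (hint.mono_set Set.Ioc_subset_Ioi_self) (hint.mono_set (Set.Ioi_subset_Ioi zero_le_one))]
  have e1 : ∫ t in Set.Ioc (0 : ℝ) 1, Real.rpowIntegrand₀₁ a t 1 ≤ 1 / a := by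
    have hi : IntegrableOn (fun t : ℝ => t ^ (a - 1)) (Set.Ioc 0 1) :=
      (intervalIntegrable_iff_integrableOn_Ioc_of_le zero_le_one).1
        (intervalIntegral.intervalIntegrable_rpow' (by linarith))
    calc _ ≤ ∫ t in Set.Ioc (0 : ℝ) 1, t ^ (a - 1) := by
          refine setIntegral_mono_on (hint.mono_set Set.Ioc_subset_Ioi_self) hi
            measurableSet_Ioc fun t ht => ?_
          rw [Real.rpowIntegrand₀₁_eq_pow_div ⟨h0, h1⟩ ht.1.le zero_le_one, mul_one]
          exact div_le_self (Real.rpow_nonneg ht.1.le _) (by linarith [ht.1])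
      _ = 1 / a := by
          rw [← intervalIntegral.integral_of_le zero_le_one, integral_rpow (Or.inl (by linarith))]
          simp [h0.ne']
  have e2 : ∫ t in Set.Ioi (1 : ℝ), Real.rpowIntegrand₀₁ a t 1 ≤ 1 / (1 - a) := by
    have hi : IntegrableOn (fun t : ℝ => t ^ (a - 2)) (Set.Ioi 1) :=
      integrableOn_Ioi_rpow_of_lt (by linarith) zero_lt_one
    calc _ ≤ ∫ t in Set.Ioi (1 : ℝ), t ^ (a - 2) := by
          refine setIntegral_mono_on (hint.mono_set (Set.Ioi_subset_Ioi zero_le_one)) hi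
            measurableSet_Ioi fun t ht => ?_
          have ht0 : (0 : ℝ) < t := lt_trans zero_lt_one ht
          rw [Real.rpowIntegrand₀₁_eq_pow_div ⟨h0, h1⟩ ht0.le zero_le_one, mul_one,
            show a - 2 = a - 1 - 1 by ring, Real.rpow_sub_one ht0.ne' (a - 1)]
          exact div_le_div_of_nonneg_left (Real.rpow_nonneg ht0.le _) ht0 (by linarith)
      _ = 1 / (1 - a) := by
          rw [integral_Ioi_rpow_of_lt (by linarith) zero_lt_one, Real.one_rpow,
            ← neg_div_neg_eq, neg_neg]
          congr 1; ring
  have e3 : 1 / a + 1 / (1 - a) = 1 / (a * (1 - a)) := by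
    have : 1 - a ≠ 0 := by linarith
    field_simp; ring
  linarith

/-- The sine is at most `π * min a (1 - a)`, and the larger of `a` and `1 - a` is at least `1/2`. -/
theorem sin_pi_mul_le {a : ℝ} (h0 : 0 ≤ a) (h1 : a ≤ 1) :
    Real.sin (Real.pi * a) ≤ 2 * Real.pi * (a * (1 - a)) := by
  have hp := Real.pi_pos
  have e1 : Real.sin (Real.pi * a) ≤ Real.pi * a := Real.sin_le (by positivity)
  have e2 : Real.sin (Real.pi * a) ≤ Real.pi * (1 - a) := by
    rw [← Real.sin_pi_sub, ← mul_one_sub]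
    exact Real.sin_le (by nlinarith)
  rcases le_total a (1 / 2) with h | h
  · nlinarith [mul_nonneg (mul_nonneg hp.le h0) (by linarith : 0 ≤ 1 - 2 * a)]
  · nlinarith [mul_nonneg (mul_nonneg hp.le (by linarith : 0 ≤ 1 - a))
      (by linarith : 0 ≤ 2 * a - 1)]

open MeasureTheory in
theorem integrableOn_exp_mul_cos {τ : ℝ} (hτ : 0 < τ) (x : ℝ) :
    IntegrableOn (fun s : ℝ => Real.exp (-τ * s) * Real.cos (x * s)) (Set.Ioi 0) := by
  have h := integrableOn_exp_mul_complex_Ioi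
    (a := (-τ : ℝ) + x * Complex.I) (by simpa using hτ) 0
  refine IntegrableOn.congr_fun h.re (fun s _ => ?_) measurableSet_Ioi
  simp [Complex.exp_re, Complex.mul_re]

open MeasureTheory in
theorem integral_exp_mul_cos {τ : ℝ} (hτ : 0 < τ) (x : ℝ) :
    ∫ s in Set.Ioi (0 : ℝ), Real.exp (-τ * s) * Real.cos (x * s) = τ / (τ ^ 2 + x ^ 2) := by
  have ha : (((-τ : ℝ) : ℂ) + x * Complex.I).re < 0 := by simpa using hτ
  have h := integrableOn_exp_mul_complex_Ioi ha 0
  have h2 := integral_exp_mul_complex_Ioi ha 0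
  have h3 := integral_re h
  rw [h2] at h3
  have : ∀ s : ℝ, Real.exp (-τ * s) * Real.cos (x * s) =
      RCLike.re (Complex.exp ((((-τ : ℝ) : ℂ) + x * Complex.I) * s)) := by
    intro s; simp [Complex.exp_re, Complex.mul_re]
  simp_rw [this, h3]
  simp [Complex.div_re, Complex.normSq_apply]
  field_simp

open MeasureTheory in
theorem integrableOn_exp_mul_sin_pow {τ : ℝ} (hτ : 0 < τ) (n : ℕ) :
    IntegrableOn (fun s : ℝ => Real.exp (-τ * s) * Real.sin s ^ n) (Set.Ioi 0) := by
  refine (integrableOn_exp_mul_Ioi (a := -τ) (by linarith) 0).mono'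
    (Continuous.aestronglyMeasurable (by fun_prop)) (.of_forall fun s => ?_)
  rw [norm_mul, norm_pow, Real.norm_eq_abs, Real.norm_eq_abs, Real.abs_exp]
  exact mul_le_of_le_one_right (Real.exp_pos _).le
    (pow_le_one₀ (abs_nonneg _) (Real.abs_sin_le_one s))

open MeasureTheory in
-- Only the window of length `1 / √n` to the left of `π / 2` is kept. There `sin s ≥ 1 - (π/2 - s)²
-- / 2`, and Bernoulli's inequality gives `sin s ^ n ≥ 1/2`.
theorem le_integral_exp_mul_sin_pow {τ : ℝ} (hτ : 0 < τ) {n : ℕ} (hn : Even n) (hn0 : 0 < n) :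
    Real.exp (-(Real.pi / 2) * τ) / (2 * √n) ≤
      ∫ s in Set.Ioi (0 : ℝ), Real.exp (-τ * s) * Real.sin s ^ n := by
  have hi := integrableOn_exp_mul_sin_pow hτ n
  have hn1 : (1 : ℝ) ≤ n := by exact_mod_cast hn0
  have hsq : 1 ≤ √(n : ℝ) := Real.one_le_sqrt.2 hn1
  have hinv : 1 / √(n : ℝ) ≤ 1 := by rw [div_le_one (by positivity)]; exact hsq
  have hpi := Real.pi_gt_three
  have hsub : Set.Ioc (Real.pi / 2 - 1 / √n) (Real.pi / 2) ⊆ Set.Ioi (0 : ℝ) := by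
    intro s hs; have := hs.1; simp only [Set.mem_Ioi]; linarith
  calc Real.exp (-(Real.pi / 2) * τ) / (2 * √n)
      = ∫ _ in Set.Ioc (Real.pi / 2 - 1 / √n) (Real.pi / 2),
          Real.exp (-(Real.pi / 2) * τ) / 2 := by
        rw [setIntegral_const, Measure.real, Real.volume_Ioc, ENNReal.toReal_ofReal (by
          have : 0 ≤ 1 / √(n : ℝ) := by positivity
          linarith), smul_eq_mul]
        field_simp; ring
    _ ≤ ∫ s in Set.Ioc (Real.pi / 2 - 1 / √n) (Real.pi / 2),
          Real.exp (-τ * s) * Real.sin s ^ n := by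
        refine setIntegral_mono_on (by simp) (hi.mono_set hsub) measurableSet_Ioc fun s hs => ?_
        rw [div_eq_mul_one_div]
        have hs1 : Real.pi / 2 - s ≤ 1 / √n := by linarith [hs.1]
        have hs2 : 0 ≤ Real.pi / 2 - s := by linarith [hs.2]
        have hsq2 : (Real.pi / 2 - s) ^ 2 ≤ 1 / n := by
          calc _ ≤ (1 / √(n : ℝ)) ^ 2 := by gcongr
            _ = 1 / n := by rw [div_pow, one_pow, Real.sq_sqrt (by positivity)]
        refine mul_le_mul (Real.exp_le_exp.2 (by nlinarith [hs.2])) ?_ (by norm_num)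
          (Real.exp_pos _).le
        have hb := one_add_mul_le_pow (a := -((Real.pi / 2 - s) ^ 2 / 2))
          (by nlinarith) n
        have hc : 1 - (Real.pi / 2 - s) ^ 2 / 2 ≤ Real.sin s := by
          rw [← Real.cos_pi_div_two_sub]; exact Real.one_sub_sq_div_two_le_cos
        calc (1 / 2 : ℝ) ≤ 1 + n * -((Real.pi / 2 - s) ^ 2 / 2) := by
              have : (n : ℝ) * (Real.pi / 2 - s) ^ 2 ≤ n * (1 / n) := by gcongr
              rw [mul_one_div_cancel (by positivity)] at this
              linarith
          _ ≤ (1 + -((Real.pi / 2 - s) ^ 2 / 2)) ^ n := hb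
          _ ≤ _ := by
              refine pow_le_pow_left₀ ?_ (by linarith) n
              have : 1 / (n : ℝ) ≤ 1 := by rw [div_le_one (by positivity)]; exact hn1
              linarith
    _ ≤ _ := setIntegral_mono_set hi
        (.of_forall fun s => mul_nonneg (Real.exp_pos _).le (hn.pow_nonneg _))
        (.of_forall hsub)

theorem pow_succ_div_add_eq_geom_sum {t y : ℝ} (h : t + y ≠ 0) (N : ℕ) :
    y ^ (N + 1) / (t + y) =
      ∑ i ∈ Finset.range (N + 1), y ^ i * (-t) ^ (N - i) + (-t) ^ (N + 1) / (t + y) := by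
  have := Commute.geom_sum₂_mul (Commute.all y (-t)) (N + 1)
  rw [div_eq_iff h, add_mul, div_mul_cancel₀ _ h]
  have e : t + y = y - -t := by ring
  rw [e]
  simp only [Nat.add_sub_cancel] at this
  linarith

open MeasureTheory in
/-- A signed combination of `p`-th powers whose low even moments vanish is bounded from below when
the corresponding combination of cosines is a multiple of an even power of the sine. -/
theorem le_sum_mul_abs_rpow {ι : Type*} [Fintype ι] {w x : ι → ℝ} {M p : ℝ} {n : ℕ}
    (hn : Even n) (hn0 : 0 < n) (hM : 0 ≤ M) (hp : 1 ≤ p)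
    (hcos : ∀ s, ∑ u, w u * Real.cos (x u * s) = M * Real.sin s ^ n)
    (hmom : ∀ j ≤ ⌊p / 2⌋₊, ∑ u, w u * (x u ^ 2) ^ j = 0) :
    M * |Real.sin (Real.pi * p / 2)| / (2 * Real.pi) * Real.Gamma (p + 1) *
        (2 / Real.pi) ^ (p + 1) / √n
      ≤ (-1) ^ (⌊p / 2⌋₊ + 1) * ∑ u, w u * |x u| ^ p := by
  set N := ⌊p / 2⌋₊ with hN
  have hp2 : 0 ≤ p / 2 := by linarith
  have hfl : (N : ℝ) ≤ p / 2 := Nat.floor_le hp2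
  have hlt : p / 2 < N + 1 := Nat.lt_floor_add_one _
  have hxp : ∀ u, |x u| ^ p = (x u ^ 2) ^ (p / 2) := fun u => by
    rw [← sq_abs, ← Real.rpow_natCast, ← Real.rpow_mul (abs_nonneg _)]
    congr 1; push_cast; ring
  -- If `p` is an even integer, the sine factor is zero and the `p`-th moment is itself one of the
  -- vanishing moments.
  rcases hfl.eq_or_lt with heq | hNlt
  · have h1 : Real.sin (Real.pi * p / 2) = 0 := by
      rw [mul_div_assoc, ← heq, mul_comm]; exact Real.sin_nat_mul_pi N
    have h2 : ∑ u, w u * |x u| ^ p = 0 := by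
      rw [← hmom N le_rfl]
      refine Finset.sum_congr rfl fun u _ => ?_
      rw [hxp, ← heq, Real.rpow_natCast]
    simp [h1, h2]
  set a := p / 2 - N with ha
  have hab : a ∈ Set.Ioo (0 : ℝ) 1 := ⟨by linarith, by linarith⟩
  set C := ∫ t in Set.Ioi (0 : ℝ), Real.rpowIntegrand₀₁ a t 1 with hC
  have hC0 : 0 < C := Real.integral_rpowIntegrand₀₁_one_pos hab
  have hCle : C ≤ 1 / (a * (1 - a)) := integral_rpowIntegrand₀₁_one_le hab
  have hsin : |Real.sin (Real.pi * p / 2)| / (2 * Real.pi) ≤ C⁻¹ := by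
    have h1 : Real.sin (Real.pi * p / 2) = (-1) ^ N * Real.sin (Real.pi * a) := by
      have : Real.pi * p / 2 = Real.pi * a + N * Real.pi := by rw [ha]; ring
      rw [this, Real.sin_add_nat_mul_pi]
    have h2 : 0 ≤ Real.sin (Real.pi * a) := Real.sin_nonneg_of_nonneg_of_le_pi
      (mul_nonneg Real.pi_pos.le hab.1.le) (mul_le_of_le_one_right Real.pi_pos.le hab.2.le)
    rw [h1, abs_mul, abs_pow, abs_neg, abs_one, one_pow, one_mul, abs_of_nonneg h2,
      div_le_iff₀ (by positivity)]
    have h3 : a * (1 - a) ≤ C⁻¹ := by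
      have h4 : 0 < a * (1 - a) := mul_pos hab.1 (by linarith [hab.2])
      rw [le_inv_comm₀ h4 hC0, inv_eq_one_div]; exact hCle
    calc _ ≤ _ := sin_pi_mul_le hab.1.le hab.2.le
      _ ≤ C⁻¹ * (2 * Real.pi) := by rw [mul_comm]; gcongr
  -- With `p / 2 = a + N`, only the fractional power `a` is represented by the integral; the integer
  -- power `N` stays as a factor.
  have hpow : ∀ u, |x u| ^ p =
      C⁻¹ * ∫ t in Set.Ioi (0 : ℝ), Real.rpowIntegrand₀₁ a t (x u ^ 2) * (x u ^ 2) ^ N := by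
    intro u
    rw [hxp, integral_mul_const, ← mul_assoc,
      ← Real.rpow_eq_const_mul_integral hab (sq_nonneg _), ← Real.rpow_natCast (x u ^ 2) N,
      ← Real.rpow_add' (sq_nonneg _) (by rw [ha]; linarith)]
    congr 1; rw [ha]; ring
  have hint : ∀ u, IntegrableOn
      (fun t => w u * (Real.rpowIntegrand₀₁ a t (x u ^ 2) * (x u ^ 2) ^ N)) (Set.Ioi 0) := fun u =>
    ((Real.integrableOn_rpowIntegrand₀₁_Ioi hab (sq_nonneg _)).mul_const _).const_mul _
  have hsum : ∑ u, w u * |x u| ^ p = C⁻¹ * ∫ t in Set.Ioi (0 : ℝ),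
      ∑ u, w u * (Real.rpowIntegrand₀₁ a t (x u ^ 2) * (x u ^ 2) ^ N) := by
    rw [integral_finsetSum _ fun u _ => hint u, Finset.mul_sum]
    refine Finset.sum_congr rfl fun u _ => ?_
    rw [hpow, integral_const_mul]; ring
  have hLap : ∀ τ : ℝ, 0 < τ → ∑ u, w u / (τ ^ 2 + x u ^ 2) =
      τ⁻¹ * (M * ∫ s in Set.Ioi (0 : ℝ), Real.exp (-τ * s) * Real.sin s ^ n) := by
    intro τ hτ
    calc _ = ∑ u, τ⁻¹ * ∫ s in Set.Ioi (0 : ℝ),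
            w u * (Real.exp (-τ * s) * Real.cos (x u * s)) := by
          refine Finset.sum_congr rfl fun u _ => ?_
          rw [integral_const_mul, integral_exp_mul_cos hτ]
          field_simp
      _ = _ := by
          rw [← Finset.mul_sum, ← integral_finsetSum _ fun u _ =>
            (integrableOn_exp_mul_cos hτ (x u)).const_mul (w u), ← integral_const_mul M]
          congr 2
          funext s
          rw [mul_left_comm, ← hcos, Finset.mul_sum]
          exact Finset.sum_congr rfl fun u _ => by ring
  -- Pointwise in `t`, the remainder `(-t) ^ (N + 1)` of the division carries the sign that `(-1) ^
  -- (N + 1)` cancels.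
  have hpt : ∀ t ∈ Set.Ioi (0 : ℝ),
      M / (2 * √n) * (t ^ ((p - 1) / 2) * Real.exp (-(Real.pi / 2) * t ^ (1 / 2 : ℝ))) ≤
      (-1) ^ (N + 1) * ∑ u, w u * (Real.rpowIntegrand₀₁ a t (x u ^ 2) * (x u ^ 2) ^ N) := by
    intro t ht
    have ht : 0 < t := ht
    have hτ : 0 < √t := Real.sqrt_pos.2 ht
    have e1 : ∑ u, w u * (Real.rpowIntegrand₀₁ a t (x u ^ 2) * (x u ^ 2) ^ N) =
        t ^ (a - 1) * ((-t) ^ (N + 1) * ∑ u, w u / (√t ^ 2 + x u ^ 2)) := by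
      calc _ = ∑ u, t ^ (a - 1) * (∑ i ∈ Finset.range (N + 1),
              (-t) ^ (N - i) * (w u * (x u ^ 2) ^ i) +
              (-t) ^ (N + 1) * (w u / (√t ^ 2 + x u ^ 2))) := by
            refine Finset.sum_congr rfl fun u _ => ?_
            have h := pow_succ_div_add_eq_geom_sum
              (t := t) (y := x u ^ 2) (by positivity) N
            rw [Real.rpowIntegrand₀₁_eq_pow_div hab ht.le (sq_nonneg _), Real.sq_sqrt ht.le]
            calc _ = t ^ (a - 1) * (w u * ((x u ^ 2) ^ (N + 1) / (t + x u ^ 2))) := by ring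
              _ = _ := by
                rw [h, mul_add, Finset.mul_sum]
                congr 2
                · exact Finset.sum_congr rfl fun i _ => by ring
                · ring
        _ = _ := by
            rw [← Finset.mul_sum, Finset.sum_add_distrib, Finset.sum_comm, Finset.mul_sum]
            congr 1
            rw [add_eq_right]
            refine Finset.sum_eq_zero fun i hi => ?_
            rw [← Finset.mul_sum, hmom i (by simpa [Nat.lt_succ_iff] using hi), mul_zero]
    rw [e1, hLap _ hτ, neg_pow t]
    have e2 : t ^ ((p - 1) / 2) = t ^ (a - 1) * (t ^ (N + 1) * (√t)⁻¹) := by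
      rw [Real.sqrt_eq_rpow, ← Real.rpow_neg ht.le, ← Real.rpow_natCast, ← Real.rpow_add ht,
        ← Real.rpow_add ht]
      congr 1; rw [ha]; push_cast; ring
    have e3 : ((-1 : ℝ) ^ (N + 1)) * (-1) ^ (N + 1) = 1 := by
      rw [← mul_pow]; norm_num
    have hl := le_integral_exp_mul_sin_pow hτ hn hn0
    rw [e2, ← Real.sqrt_eq_rpow]
    calc _ = t ^ (a - 1) * (t ^ (N + 1) * (√t)⁻¹) *
          (M * (Real.exp (-(Real.pi / 2) * √t) / (2 * √n))) := by ring
      _ ≤ t ^ (a - 1) * (t ^ (N + 1) * (√t)⁻¹) *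
          (M * ∫ s in Set.Ioi (0 : ℝ), Real.exp (-√t * s) * Real.sin s ^ n) := by gcongr
      _ = ((-1 : ℝ) ^ (N + 1) * (-1) ^ (N + 1)) * (t ^ (a - 1) * (t ^ (N + 1) * (√t)⁻¹) *
          (M * ∫ s in Set.Ioi (0 : ℝ), Real.exp (-√t * s) * Real.sin s ^ n)) := by
            rw [e3, one_mul]
      _ = _ := by ring
  -- The substitution `t = r ^ 2` turns this into a Gamma integral, which is the source of `Γ(p +
  -- 1)` and of `(2 / π) ^ (p + 1)`.
  have hI : ∫ t in Set.Ioi (0 : ℝ),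
      t ^ ((p - 1) / 2) * Real.exp (-(Real.pi / 2) * t ^ (1 / 2 : ℝ)) =
      2 * Real.Gamma (p + 1) * (2 / Real.pi) ^ (p + 1) := by
    rw [integral_rpow_mul_exp_neg_mul_rpow (by norm_num) (by linarith) (by positivity)]
    have e1 : ((p - 1) / 2 + 1) / (1 / 2 : ℝ) = p + 1 := by ring
    have e2 : -((p - 1) / 2 + 1) / (1 / 2 : ℝ) = -(p + 1) := by ring
    rw [e1, e2, Real.rpow_neg (by positivity), ← Real.inv_rpow (by positivity), inv_div]
    ring
  have hmono := setIntegral_mono_on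
    ((integrableOn_rpow_mul_exp_neg_mul_rpow (s := (p - 1) / 2) (p := 1 / 2) (b := Real.pi / 2)
      (by linarith) (by norm_num) (by positivity)).const_mul (M / (2 * √n)))
    ((integrable_finsetSum Finset.univ fun u _ => hint u).const_mul ((-1) ^ (N + 1)))
    measurableSet_Ioi hpt
  rw [integral_const_mul, integral_const_mul, hI] at hmono
  rw [hsum, mul_left_comm]
  have hG : 0 < Real.Gamma (p + 1) := Real.Gamma_pos_of_pos (by linarith)
  calc _ = |Real.sin (Real.pi * p / 2)| / (2 * Real.pi) *
        (M / (2 * √n) * (2 * Real.Gamma (p + 1) * (2 / Real.pi) ^ (p + 1))) := by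
        field_simp
    _ ≤ C⁻¹ * (M / (2 * √n) * (2 * Real.Gamma (p + 1) * (2 / Real.pi) ^ (p + 1))) := by gcongr
    _ ≤ _ := by gcongr

/-! ### Signed and absolute sums over the cube -/

theorem sum_fin_succ_units {k : ℕ} (f : (Fin (k + 1) → ℤˣ) → ℝ) :
    ∑ u, f u = ∑ u : Fin k → ℤˣ, (f (Fin.cons 1 u) + f (Fin.cons (-1) u)) := by
  rw [← (Fin.consEquiv fun _ : Fin (k + 1) => ℤˣ).sum_comp, Fintype.sum_prod_type,
    UnitsInt.univ, Finset.sum_pair (by decide), Finset.sum_add_distrib]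
  rfl

/-- Signed sums over the cube `{-1, 1}^k` annihilate powers of affine forms below degree `k`. -/
theorem sum_prod_mul_affine_pow {k : ℕ} (v : Fin k → ℝ) (x : ℝ) {q : ℕ} (hq : q < k) :
    ∑ u : Fin k → ℤˣ, (∏ i, (((u i : ℤˣ) : ℤ) : ℝ)) *
      (x + ∑ i, v i * (((u i : ℤˣ) : ℤ) : ℝ)) ^ q = 0 := by
  induction k generalizing q with
  | zero => omega
  | succ k ih =>
    rw [sum_fin_succ_units]
    simp only [Fin.prod_univ_succ, Fin.sum_univ_succ, Fin.cons_zero, Fin.cons_succ]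
    -- Summing over the first coordinate takes a difference in direction `v 0`: the top term `l = q`
    -- cancels, so the degree drops together with the dimension.
    calc _ = ∑ u : Fin k → ℤˣ, ∑ l ∈ Finset.range q,
          (v 0 ^ (q - l) - (-v 0) ^ (q - l)) * q.choose l * ((∏ i, (((u i : ℤˣ) : ℤ) : ℝ)) *
            (x + ∑ i, v i.succ * (((u i : ℤˣ) : ℤ) : ℝ)) ^ l) := by
          refine Finset.sum_congr rfl fun u _ => ?_
          set P := ∏ i, (((u i : ℤˣ) : ℤ) : ℝ)
          set S := ∑ i, v i.succ * (((u i : ℤˣ) : ℤ) : ℝ)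
          have e1 : (x + (v 0 * (((1 : ℤˣ) : ℤ) : ℝ) + S)) = (x + S) + v 0 := by
            push_cast; ring
          have e2 : (x + (v 0 * (((-1 : ℤˣ) : ℤ) : ℝ) + S)) = (x + S) + -v 0 := by
            push_cast; ring
          rw [e1, e2, add_pow, add_pow, Finset.sum_range_succ, Finset.sum_range_succ]
          have e3 : ∀ l, (v 0 ^ (q - l) - (-v 0) ^ (q - l)) * (q.choose l : ℝ) * (P * (x + S) ^ l)
              = P * ((x + S) ^ l * v 0 ^ (q - l) * q.choose l) -
                P * ((x + S) ^ l * (-v 0) ^ (q - l) * q.choose l) := fun l => by ring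
          simp only [e3, Finset.sum_sub_distrib, ← Finset.mul_sum]
          push_cast
          simp only [Nat.sub_self, pow_zero, Nat.choose_self]
          ring
      _ = 0 := by
          rw [Finset.sum_comm]
          refine Finset.sum_eq_zero fun l hl => ?_
          rw [← Finset.mul_sum, ih _ (by have := Finset.mem_range.1 hl; omega), mul_zero]

/-- The affine form `∑ i, u i - t` at which the moments are evaluated, with `t = parityShift k`. -/
noncomputable def cubeForm (k : ℕ) (u : Fin k → ℤˣ) : ℝ := ∑ i, (((u i : ℤˣ) : ℤ) : ℝ) - parityShift k

theorem sum_prod_mul_cubeForm_pow {k q : ℕ} (hq : q < k) :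
    ∑ u : Fin k → ℤˣ, (∏ i, (((u i : ℤˣ) : ℤ) : ℝ)) * cubeForm k u ^ q = 0 := by
  rw [← sum_prod_mul_affine_pow (fun _ => 1) (-parityShift k) hq]
  simp only [cubeForm, one_mul, sub_eq_neg_add]

theorem sum_units_prod {R : Type*} [CommRing R] (k : ℕ) (f : ℤˣ → R) :
    ∑ u : Fin k → ℤˣ, ∏ i, f (u i) = (f 1 + f (-1)) ^ k := by
  have h := Finset.prod_univ_sum (fun _ : Fin k => (Finset.univ : Finset ℤˣ)) (fun _ j => f j)
  rw [Fintype.piFinset_univ] at h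
  rw [← h, UnitsInt.univ, Finset.sum_pair (by decide), Finset.prod_const, Finset.card_univ,
    Fintype.card_fin]

theorem parityShift_two_mul (m : ℕ) : parityShift (2 * m) = 0 := by
  simp [parityShift, pow_succ, pow_mul]

theorem parityShift_two_mul_add_one (m : ℕ) : parityShift (2 * m + 1) = 1 := by
  simp [parityShift, pow_succ, pow_mul]

theorem sum_prod_mul_cexp (k : ℕ) (s : ℝ) :
    ∑ u : Fin k → ℤˣ, ((∏ i, (((u i : ℤˣ) : ℤ) : ℝ) : ℝ) : ℂ) *
      Complex.exp (((∑ i, (((u i : ℤˣ) : ℤ) : ℝ)) * s : ℝ) * Complex.I) =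
      (2 * Complex.I * Real.sin s) ^ k := by
  have h := sum_units_prod k
    fun e : ℤˣ => (((e : ℤ) : ℝ) : ℂ) * Complex.exp ((((e : ℤ) : ℝ) * s : ℝ) * Complex.I)
  have e : ((((1 : ℤˣ) : ℤ) : ℝ) : ℂ) * Complex.exp (((((1 : ℤˣ) : ℤ) : ℝ) * s : ℝ) * Complex.I) +
      ((((-1 : ℤˣ) : ℤ) : ℝ) : ℂ) * Complex.exp (((((-1 : ℤˣ) : ℤ) : ℝ) * s : ℝ) * Complex.I) =
      2 * Complex.I * Real.sin s := by
    push_cast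
    rw [one_mul, one_mul, neg_one_mul, neg_one_mul, Complex.sin]
    linear_combination (Complex.exp (s * Complex.I) - Complex.exp (-(s : ℂ) * Complex.I)) *
      Complex.I_sq
  rw [e] at h
  rw [← h]
  refine Finset.sum_congr rfl fun u _ => ?_
  rw [Finset.prod_mul_distrib, ← Complex.exp_sum, ← Finset.sum_mul, Finset.sum_mul,
    Complex.ofReal_prod, Complex.ofReal_sum]

/-- The exponential sum factors as `(2i sin s) ^ k`. For odd `k` this is purely imaginary and its
real part would vanish; the shift by 1 multiplies it by `exp (-i s)`, whose imaginary part supplies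
one more sine. Hence the even exponent `2⌈k/2⌉` in both parities. -/
theorem sum_prod_mul_cos_cubeForm (k : ℕ) (s : ℝ) :
    ∑ u : Fin k → ℤˣ, (∏ i, (((u i : ℤˣ) : ℤ) : ℝ)) * Real.cos (cubeForm k u * s) =
      (-1) ^ (k / 2) * 2 ^ k * Real.sin s ^ (2 * ((k + 1) / 2)) := by
  have h : ∑ u : Fin k → ℤˣ, (∏ i, (((u i : ℤˣ) : ℤ) : ℝ)) * Real.cos (cubeForm k u * s) =
      (Complex.exp ((-(parityShift k * s) : ℝ) * Complex.I) *
        (2 * Complex.I * Real.sin s) ^ k).re := by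
    rw [← sum_prod_mul_cexp, Finset.mul_sum, Complex.re_sum]
    refine Finset.sum_congr rfl fun u _ => ?_
    rw [mul_left_comm, ← Complex.exp_add, ← add_mul, ← Complex.ofReal_add, Complex.re_ofReal_mul,
      Complex.exp_ofReal_mul_I_re, cubeForm]
    congr 2; ring
  rw [h]
  have hI : ∀ m : ℕ, (2 * Complex.I * Real.sin s) ^ (2 * m) =
      (((-1) ^ m * 2 ^ (2 * m) * Real.sin s ^ (2 * m) : ℝ) : ℂ) := fun m => by
    rw [mul_pow, mul_pow, pow_mul Complex.I, Complex.I_sq]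
    push_cast; ring
  rcases Nat.even_or_odd' k with ⟨m, rfl | rfl⟩
  · rw [parityShift_two_mul, hI, show 2 * m / 2 = m by omega,
      show 2 * ((2 * m + 1) / 2) = 2 * m by omega]
    simp only [zero_mul, neg_zero, Complex.ofReal_zero, Complex.exp_zero, one_mul,
      Complex.ofReal_re]
  · rw [parityShift_two_mul_add_one, pow_succ, hI, show (2 * m + 1) / 2 = m by omega,
      show 2 * ((2 * m + 1 + 1) / 2) = 2 * m + 2 by omega, mul_left_comm, Complex.re_ofReal_mul,
      one_mul, ← mul_assoc, ← Complex.ofReal_ofNat, mul_comm (Complex.exp _),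
      Complex.re_mul_ofReal, mul_assoc ((2 : ℝ) : ℂ), Complex.re_ofReal_mul, Complex.I_mul_re,
      Complex.exp_ofReal_mul_I_im, Real.sin_neg]
    ring

/-- The exponential sum factors as `(2 cosh l) ^ k`; for odd `k` the shift contributes one further
factor `cosh l`. -/
theorem sum_cosh_cubeForm (k : ℕ) (l : ℝ) :
    ∑ u : Fin k → ℤˣ, 2 * Real.cosh (l * cubeForm k u) =
      2 ^ (k + 1) * Real.cosh l ^ (2 * ((k + 1) / 2)) := by
  have hs : ∀ l : ℝ, ∑ u : Fin k → ℤˣ, Real.exp (l * ∑ i, (((u i : ℤˣ) : ℤ) : ℝ)) =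
      (2 * Real.cosh l) ^ k := by
    intro l
    have h := sum_units_prod k fun e : ℤˣ => Real.exp (l * ((e : ℤ) : ℝ))
    push_cast at h
    rw [mul_neg, mul_one] at h
    rw [Real.cosh_eq, mul_div_cancel₀ _ two_ne_zero, ← h]
    exact Finset.sum_congr rfl fun u _ => by rw [Finset.mul_sum, Real.exp_sum]
  have h : ∑ u : Fin k → ℤˣ, 2 * Real.cosh (l * cubeForm k u) =
      2 * Real.cosh (l * parityShift k) * (2 * Real.cosh l) ^ k := by
    have h1 := hs l
    have h2 := hs (-l)
    rw [Real.cosh_neg] at h2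
    calc _ = ∑ u : Fin k → ℤˣ, (Real.exp (-(l * parityShift k)) *
            Real.exp (l * ∑ i, (((u i : ℤˣ) : ℤ) : ℝ)) + Real.exp (l * parityShift k) *
            Real.exp (-l * ∑ i, (((u i : ℤˣ) : ℤ) : ℝ))) := by
          refine Finset.sum_congr rfl fun u _ => ?_
          rw [Real.cosh_eq, ← Real.exp_add, ← Real.exp_add, mul_div_cancel₀ _ two_ne_zero, cubeForm]
          congr 2 <;> ring
      _ = _ := by
          rw [Finset.sum_add_distrib, ← Finset.mul_sum, ← Finset.mul_sum, h1, h2,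
            Real.cosh_eq (l * parityShift k)]
          ring
  rw [h]
  rcases Nat.even_or_odd' k with ⟨m, rfl | rfl⟩
  · rw [parityShift_two_mul, show 2 * ((2 * m + 1) / 2) = 2 * m by omega]
    rw [mul_zero, Real.cosh_zero]; ring
  · rw [parityShift_two_mul_add_one, show 2 * ((2 * m + 1 + 1) / 2) = 2 * m + 2 by omega,
      mul_one]
    ring

/-- Raise `y ≤ exp (y - 1)` at `y = l |x| / p` to the power `p`, then use `exp (l |x|) ≤ 2 cosh (l
x)`. -/
theorem abs_rpow_le_mul_cosh {p l : ℝ} (hp : 0 < p) (hl : 0 < l) (x : ℝ) :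
    |x| ^ p ≤ (p / (Real.exp 1 * l)) ^ p * (2 * Real.cosh (l * x)) := by
  have h1 : l * |x| / p ≤ Real.exp (l * |x| / p - 1) := by
    have := Real.add_one_le_exp (l * |x| / p - 1); linarith
  have h2 : |x| ≤ p / (Real.exp 1 * l) * Real.exp (l * |x| / p) := by
    rw [Real.exp_sub] at h1
    calc |x| = p / l * (l * |x| / p) := by field_simp
      _ ≤ p / l * (Real.exp (l * |x| / p) / Real.exp 1) := by gcongr
      _ = _ := by field_simp
  have h3 : Real.exp (l * |x|) ≤ 2 * Real.cosh (l * x) := by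
    rw [Real.cosh_eq, mul_div_cancel₀ _ two_ne_zero]
    rcases abs_cases x with ⟨h, _⟩ | ⟨h, _⟩ <;> rw [h]
    · linarith [Real.exp_pos (-(l * x))]
    · rw [mul_neg]; linarith [Real.exp_pos (l * x)]
  calc |x| ^ p ≤ (p / (Real.exp 1 * l) * Real.exp (l * |x| / p)) ^ p := by gcongr
    _ = (p / (Real.exp 1 * l)) ^ p * Real.exp (l * |x|) := by
        rw [Real.mul_rpow (by positivity) (Real.exp_pos _).le, ← Real.exp_mul,
          div_mul_cancel₀ _ hp.ne']
    _ ≤ _ := by gcongr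

/-- A Khintchine-type upper bound for the absolute moments. -/
theorem sum_abs_cubeForm_rpow_le {k : ℕ} (hk : 0 < k) {p : ℝ} (hp : 0 < p) :
    ∑ u : Fin k → ℤˣ, |cubeForm k u| ^ p ≤
      2 ^ (k + 1) * (p * (2 * ((k + 1) / 2) : ℕ) / Real.exp 1) ^ (p / 2) := by
  set n := 2 * ((k + 1) / 2) with hn
  have hn0 : (0 : ℝ) < n := by exact_mod_cast (by omega : 0 < n)
  -- This `l` minimises `l ^ (-p) * exp (n l² / 2)`.
  set l := √(p / n) with hl
  have hl0 : 0 < l := Real.sqrt_pos.2 (by positivity)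
  have hl2 : l ^ 2 = p / n := Real.sq_sqrt (by positivity)
  calc _ ≤ ∑ u : Fin k → ℤˣ, (p / (Real.exp 1 * l)) ^ p * (2 * Real.cosh (l * cubeForm k u)) :=
        Finset.sum_le_sum fun u _ => abs_rpow_le_mul_cosh hp hl0 _
    _ = (p / (Real.exp 1 * l)) ^ p * (2 ^ (k + 1) * Real.cosh l ^ n) := by
        rw [← Finset.mul_sum, sum_cosh_cubeForm]
    _ ≤ (p / (Real.exp 1 * l)) ^ p * (2 ^ (k + 1) * Real.exp (l ^ 2 / 2) ^ n) := by
        have := (Real.cosh_pos l).le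
        gcongr
        exact Real.cosh_le_exp_half_sq l
    _ = _ := by
        have e1 : Real.exp (l ^ 2 / 2) ^ n = Real.exp 1 ^ (p / 2) := by
          rw [← Real.exp_nat_mul, ← Real.exp_mul, hl2]
          congr 1; field_simp
        have e2 : (p / (Real.exp 1 * l)) ^ p = (p * n / Real.exp 1 ^ 2) ^ (p / 2) := by
          have : p * n / Real.exp 1 ^ 2 = (p / (Real.exp 1 * l)) ^ 2 := by
            rw [div_pow, mul_pow, hl2]; field_simp
          rw [this, ← Real.rpow_natCast, ← Real.rpow_mul (by positivity)]
          congr 1; push_cast; ring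
        rw [e1, e2, mul_left_comm, ← Real.mul_rpow (by positivity) (by positivity)]
        congr 2; field_simp

/-! ### Comparison of the signed and absolute moments with the gap -/

/-- Restrict Euler's integral to `x > p`, where `x ^ p ≥ p ^ p`. -/
theorem div_exp_rpow_le_Gamma_add_one {p : ℝ} (hp : 0 < p) :
    (p / Real.exp 1) ^ p ≤ Real.Gamma (p + 1) := by
  have hi := Real.GammaIntegral_convergent (s := p + 1) (by linarith)
  rw [Real.Gamma_eq_integral (by linarith)]
  have h2 : MeasureTheory.IntegrableOn (fun x : ℝ => p ^ p * Real.exp (-x)) (Set.Ioi p) :=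
    (integrableOn_exp_neg_Ioi p).const_mul _
  calc (p / Real.exp 1) ^ p = ∫ x in Set.Ioi p, p ^ p * Real.exp (-x) := by
        rw [MeasureTheory.integral_const_mul, integral_exp_neg_Ioi,
          Real.div_rpow hp.le (Real.exp_pos _).le, ← Real.exp_mul, one_mul, Real.exp_neg]
        rfl
    _ ≤ ∫ x in Set.Ioi p, Real.exp (-x) * x ^ (p + 1 - 1) := by
        refine MeasureTheory.setIntegral_mono_on h2
          (hi.mono_set (Set.Ioi_subset_Ioi hp.le)) measurableSet_Ioi fun x hx => ?_
        have hx : p < x := hx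
        rw [mul_comm, add_sub_cancel_right]
        gcongr
    _ ≤ _ := MeasureTheory.setIntegral_mono_set hi
        ((MeasureTheory.ae_restrict_iff' measurableSet_Ioi).2 (.of_forall fun x hx =>
          mul_nonneg (Real.exp_pos _).le (Real.rpow_nonneg (le_of_lt hx) _)))
        (.of_forall (Set.Ioi_subset_Ioi hp.le))

/-- For `r < 1`, `2r` is the first term of the nonnegative series for `log ((1 + r) / (1 - r))`. It
is applied with `r = D / A`. -/
theorem exp_two_mul_mul_one_sub_le {r : ℝ} (hr : 0 ≤ r) :
    Real.exp (2 * r) * (1 - r) ≤ 1 + r := by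
  rcases lt_or_ge r 1 with h | h
  · have hs := Real.hasSum_log_sub_log_of_abs_lt_one (x := r) (by rw [abs_of_nonneg hr]; exact h)
    have h1 := hs.summable.le_tsum 0 fun j _ => by positivity
    rw [hs.tsum_eq] at h1
    simp only [Nat.cast_zero, mul_zero, zero_add, div_one, mul_one, pow_one] at h1
    rw [← le_div_iff₀ (by linarith), ← Real.le_log_iff_exp_le
      (div_pos (by linarith) (by linarith)), Real.log_div (by linarith) (by linarith)]
    exact h1
  · have : Real.exp (2 * r) * (1 - r) ≤ 0 :=
      mul_nonpos_of_nonneg_of_nonpos (Real.exp_pos _).le (by linarith)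
    linarith

theorem parityGap_nonneg (k : ℕ) {p : ℝ} (hp : 0 ≤ p) : 0 ≤ parityGap k p := by
  unfold parityGap; positivity

theorem parityGap_numeric {k : ℕ} (hk : 3 ≤ k) {p : ℝ} (hp : 1 ≤ p) :
    1 / p * (2 * p / (Real.exp 1 ^ 2 * Real.pi ^ 2 * k)) ^ ((p + 1) / 2) *
        (p * (2 * ((k + 1) / 2) : ℕ) / Real.exp 1) ^ (p / 2) ≤
      1 / (2 * Real.pi) * (p / Real.exp 1) ^ p * (2 / Real.pi) ^ (p + 1) /
        √(2 * ((k + 1) / 2) : ℕ) := by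
  set n := 2 * ((k + 1) / 2) with hn
  have hn0 : (0 : ℝ) < n := by exact_mod_cast (by omega : 0 < n)
  have hk0 : (0 : ℝ) < k := by exact_mod_cast (by omega : 0 < k)
  have hnk : (3 : ℝ) * n ≤ 4 * k := by exact_mod_cast (by omega : 3 * n ≤ 4 * k)
  have hpi := Real.pi_pos
  have hp0 : 0 < p := by linarith
  have hsq : 0 < √(n : ℝ) := Real.sqrt_pos.2 hn0
  -- The quotient of the two sides is made explicit; the identity becomes linear after taking
  -- logarithms. Since `n ≤ 4k/3` (this needs `k ≥ 3`), the quotient is at least `1.64 * 4 / (2π) >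
  -- 1`.
  have key : 1 / (2 * Real.pi) * (p / Real.exp 1) ^ p * (2 / Real.pi) ^ (p + 1) / √n =
      (√(Real.exp 1 * p) * (2 * Real.exp 1 * k / n) ^ ((p + 1) / 2) / (2 * Real.pi)) *
      (1 / p * (2 * p / (Real.exp 1 ^ 2 * Real.pi ^ 2 * k)) ^ ((p + 1) / 2) *
        (p * n / Real.exp 1) ^ (p / 2)) := by
    refine Real.log_injOn_pos (Set.mem_Ioi.2 (by positivity)) (Set.mem_Ioi.2 (by positivity)) ?_
    have he : Real.exp 1 ≠ 0 := (Real.exp_pos 1).ne'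
    have hs1 : Real.log √(n : ℝ) = Real.log n / 2 := Real.log_sqrt hn0.le
    have hs2 : Real.log √(Real.exp 1 * p) = (1 + Real.log p) / 2 := by
      rw [Real.log_sqrt (by positivity), Real.log_mul he hp0.ne', Real.log_exp]
    have hr : ∀ x y : ℝ, 0 < x → Real.log (x ^ y) = y * Real.log x := fun x y h =>
      Real.log_rpow h y
    simp (disch := positivity) only [Real.log_mul, Real.log_div, hr, Real.log_pow, Real.log_exp,
      Real.log_one, hs1, hs2]
    push_cast
    ring
  rw [key]
  refine le_mul_of_one_le_left (by positivity) ?_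
  rw [one_le_div (by positivity)]
  have he := Real.exp_one_gt_d9
  have h1 : (1.64 : ℝ) ≤ √(Real.exp 1 * p) := by
    refine Real.le_sqrt_of_sq_le ?_
    nlinarith
  have h2 : (4 : ℝ) ≤ 2 * Real.exp 1 * k / n := by
    rw [le_div_iff₀ hn0]; nlinarith
  have h3 : (4 : ℝ) ≤ (2 * Real.exp 1 * k / n) ^ ((p + 1) / 2) := by
    calc (4 : ℝ) ≤ _ := h2
      _ = (2 * Real.exp 1 * k / n) ^ (1 : ℝ) := (Real.rpow_one _).symm
      _ ≤ _ := Real.rpow_le_rpow_of_exponent_le (by linarith) (by linarith)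
  nlinarith [Real.pi_lt_d2]

/-- The absolute moment of the cube form. -/
noncomputable def cubeMoment (k : ℕ) (p : ℝ) : ℝ := ∑ u : Fin k → ℤˣ, |cubeForm k u| ^ p

/-- The signed moment of the cube form, with the sign that makes it nonnegative. -/
noncomputable def cubeSignedMoment (k : ℕ) (p : ℝ) : ℝ :=
  (-1) ^ (k / 2 + ⌊p / 2⌋₊ + 1) *
    ∑ u : Fin k → ℤˣ, (∏ i, (((u i : ℤˣ) : ℤ) : ℝ)) * |cubeForm k u| ^ p

theorem le_cubeSignedMoment {k : ℕ} (hk : 3 ≤ k) {p : ℝ} (hp : 1 ≤ p) (hpk : p < k) :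
    2 ^ k * |Real.sin (Real.pi * p / 2)| / (2 * Real.pi) * Real.Gamma (p + 1) *
        (2 / Real.pi) ^ (p + 1) / √(2 * ((k + 1) / 2) : ℕ) ≤ cubeSignedMoment k p := by
  -- The sign `(-1) ^ (k / 2)` in the weights makes the coefficient `2 ^ k` of the sine power
  -- positive. The required moments vanish because `2j ≤ p < k`.
  have h := le_sum_mul_abs_rpow (w := fun u : Fin k → ℤˣ => (-1) ^ (k / 2) *
      ∏ i, (((u i : ℤˣ) : ℤ) : ℝ)) (x := cubeForm k) (M := 2 ^ k)
    (n := 2 * ((k + 1) / 2)) (even_two_mul _) (by omega) (by positivity) hp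
    (fun s => by
      simp only [mul_assoc, ← Finset.mul_sum]
      rw [sum_prod_mul_cos_cubeForm, ← mul_assoc, ← mul_assoc, ← mul_pow]
      norm_num)
    (fun j hj => by
      have hj2 : (j : ℝ) ≤ p / 2 := le_trans (by exact_mod_cast hj) (Nat.floor_le (by linarith))
      have : 2 * j < k := by
        have : ((2 * j : ℕ) : ℝ) < k := by push_cast; linarith
        exact_mod_cast this
      simp only [← pow_mul, mul_assoc, ← Finset.mul_sum]
      rw [sum_prod_mul_cubeForm_pow this, mul_zero])
  refine h.trans (le_of_eq ?_)
  simp only [mul_assoc, ← Finset.mul_sum, cubeSignedMoment]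
  ring

theorem cubeMoment_pos {k : ℕ} (hk : 3 ≤ k) (p : ℝ) : 0 < cubeMoment k p := by
  have h1 : 0 < cubeForm k 1 := by
    have : (3 : ℝ) ≤ k := by exact_mod_cast hk
    have h2 : parityShift k ≤ 1 := by
      rcases Nat.even_or_odd' k with ⟨m, rfl | rfl⟩
      · rw [parityShift_two_mul]; exact zero_le_one
      · rw [parityShift_two_mul_add_one]
    simp [cubeForm]
    linarith
  refine Finset.sum_pos' (fun u _ => by positivity) ⟨1, Finset.mem_univ _, ?_⟩
  exact Real.rpow_pos_of_pos (abs_pos.2 h1.ne') p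

theorem cubeSignedMoment_nonneg {k : ℕ} (hk : 3 ≤ k) {p : ℝ} (hp : 1 ≤ p) (hpk : p < k) :
    0 ≤ cubeSignedMoment k p := by
  refine le_trans ?_ (le_cubeSignedMoment hk hp hpk)
  have := Real.Gamma_pos_of_pos (show 0 < p + 1 by linarith)
  positivity

theorem one_add_parityGap_rpow_mul_le {k : ℕ} (hk : 3 ≤ k) {p : ℝ} (hp : 1 ≤ p) (hpk : p < k) :
    (1 + parityGap k p) ^ p * (cubeMoment k p - cubeSignedMoment k p) ≤
      cubeMoment k p + cubeSignedMoment k p := by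
  have hA0 := cubeMoment_pos hk p
  have hD0 := cubeSignedMoment_nonneg hk hp hpk
  have hA : cubeMoment k p ≤ _ := sum_abs_cubeForm_rpow_le (k := k) (by omega) (p := p) (by linarith)
  have hD := le_cubeSignedMoment hk hp hpk
  set A := cubeMoment k p
  set D := cubeSignedMoment k p
  have hg0 := parityGap_nonneg k (p := p) (by linarith)
  have hp0 : 0 < p := by linarith
  -- The gap was chosen for this inequality: `(1 + δ) ^ p ≤ exp (p δ) ≤ exp (2D / A)` then follows.
  have hkey : p * parityGap k p * A ≤ 2 * D := by
    have hG := div_exp_rpow_le_Gamma_add_one hp0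
    have hnum := parityGap_numeric hk hp
    set n : ℕ := 2 * ((k + 1) / 2)
    calc p * parityGap k p * A ≤ p * parityGap k p *
          (2 ^ (k + 1) * (p * n / Real.exp 1) ^ (p / 2)) := by gcongr
      _ = 2 ^ (k + 1) * |Real.sin (Real.pi * p / 2)| * (1 / p *
          (2 * p / (Real.exp 1 ^ 2 * Real.pi ^ 2 * k)) ^ ((p + 1) / 2) *
          (p * n / Real.exp 1) ^ (p / 2)) := by
          unfold parityGap; field_simp
      _ ≤ 2 ^ (k + 1) * |Real.sin (Real.pi * p / 2)| * (1 / (2 * Real.pi) * (p / Real.exp 1) ^ p *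
          (2 / Real.pi) ^ (p + 1) / √n) := by gcongr
      _ ≤ 2 ^ (k + 1) * |Real.sin (Real.pi * p / 2)| * (1 / (2 * Real.pi) * Real.Gamma (p + 1) *
          (2 / Real.pi) ^ (p + 1) / √n) := by gcongr
      _ = 2 * (2 ^ k * |Real.sin (Real.pi * p / 2)| / (2 * Real.pi) * Real.Gamma (p + 1) *
          (2 / Real.pi) ^ (p + 1) / √n) := by rw [pow_succ]; ring
      _ ≤ 2 * D := by gcongr
  rcases le_total A D with h | h
  · have : (1 + parityGap k p) ^ p * (A - D) ≤ 0 :=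
      mul_nonpos_of_nonneg_of_nonpos (by positivity) (by linarith)
    linarith
  calc (1 + parityGap k p) ^ p * (A - D) ≤ Real.exp (2 * (D / A)) * (A - D) := by
        refine mul_le_mul_of_nonneg_right ?_ (by linarith)
        calc (1 + parityGap k p) ^ p ≤ Real.exp (parityGap k p) ^ p := by
              gcongr
              linarith [Real.add_one_le_exp (parityGap k p)]
          _ ≤ _ := by
              rw [← Real.exp_mul, Real.exp_le_exp, ← mul_div_assoc, le_div_iff₀ hA0]
              linarith
    _ = A * (Real.exp (2 * (D / A)) * (1 - D / A)) := by field_simp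
    _ ≤ A * (1 + D / A) := by
        gcongr; exact exp_two_mul_mul_one_sub_le (by positivity)
    _ = A + D := by field_simp

/-! ### Computable real numbers by rational enclosures -/

open Filter Topology in
/-- Real numbers that are the common limit of computable sequences of lower and upper bounds, given
as fractions of natural numbers. -/
def IsEnclosable (x : ℝ) : Prop :=
  ∃ a b c : ℕ → ℕ, Computable a ∧ Computable b ∧ Computable c ∧ (∀ n, 0 < c n) ∧
    (∀ n, (a n : ℝ) / c n ≤ x) ∧ (∀ n, x ≤ (b n : ℝ) / c n) ∧
    Tendsto (fun n => (a n : ℝ) / c n) atTop (𝓝 x) ∧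
    Tendsto (fun n => (b n : ℝ) / c n) atTop (𝓝 x)

theorem primrec_nat_pow : Primrec₂ ((· ^ ·) : ℕ → ℕ → ℕ) :=
  Primrec₂.unpaired'.1 Nat.Primrec.pow

theorem computable_nat_find {P : ℕ → ℕ → Prop} [∀ n, DecidablePred (P n)]
    (hP : Computable fun x : ℕ × ℕ => decide (P x.1 x.2)) (h : ∀ n, ∃ m, P n m) :
    Computable fun n => Nat.find (h n) := by
  have hp : Partrec fun n => Nat.rfind fun m => Part.some (decide (P n m)) :=
    Partrec.rfind (p := fun n m => Part.some (decide (P n m))) hP.partrec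
  refine hp.of_eq_tot fun n => Nat.mem_rfind.2 ⟨?_, fun {m} hm => ?_⟩
  · simpa using Nat.find_spec (h n)
  · simpa using Nat.find_min (h n) hm

/-- Integers are encoded by `q ↦ 2q` for `q ≥ 0` and `-(q + 1) ↦ 2q + 1`; this and the next two
results only unfold that encoding. -/
theorem primrec_int_ofNat : Primrec fun q : ℕ => (q : ℤ) := by
  refine Primrec.encode_iff.1 ((Primrec.nat_double).of_eq fun q => ?_)
  rfl

theorem primrec_int_neg_ofNat : Primrec fun q : ℕ => -(q : ℤ) := by
  refine Primrec.encode_iff.1 (Primrec.of_eq (f := fun q => 2 * q - 1)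
    (Primrec.nat_sub.comp Primrec.nat_double (Primrec.const 1)) fun q => ?_)
  cases q with
  | zero => rfl
  | succ q => rfl

theorem primrec_int_toNat : Primrec Int.toNat := by
  refine Primrec.of_eq (f := fun z : ℤ => if Encodable.encode z % 2 = 0 then
    Encodable.encode z / 2 else 0) ?_ fun z => ?_
  · exact Primrec.ite (Primrec.eq.comp (Primrec.nat_mod.comp Primrec.encode (Primrec.const 2))
      (Primrec.const 0)) (Primrec.nat_div.comp Primrec.encode (Primrec.const 2)) (Primrec.const 0)
  · cases z with
    | ofNat q =>
      have : Encodable.encode (Int.ofNat q) = 2 * q := rfl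
      rw [this]; simp
    | negSucc q =>
      have : Encodable.encode (Int.negSucc q) = 2 * q + 1 := rfl
      rw [this]; simp [Nat.add_mod]

theorem IsEnclosable.exists_computable {x : ℝ} (hx : IsEnclosable x) :
    ∃ f : ℕ → ℕ, Computable f ∧ ∀ n : ℕ, |x - (f n : ℝ) / 2 ^ n| ≤ 1 / 2 ^ n := by
  obtain ⟨a, b, c, ha, hb, hc, hc0, hax, hxb, hta, htb⟩ := hx
  -- The search stops at an enclosure of width at most `2 ^ (-n) / 2`. Rounding the lower end to the
  -- nearest multiple of `2 ^ (-n)` costs at most the other half.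
  have hex : ∀ n, ∃ N, (b N - a N) * 2 ^ (n + 1) ≤ c N := by
    intro n
    have ht : Filter.Tendsto (fun N => (b N : ℝ) / c N - (a N : ℝ) / c N) Filter.atTop
        (nhds 0) := by simpa using htb.sub hta
    obtain ⟨N, hN⟩ := (ht.eventually_lt_const
      (show (0 : ℝ) < 1 / 2 ^ (n + 1) by positivity)).exists
    refine ⟨N, ?_⟩
    have hcN : (0 : ℝ) < c N := by exact_mod_cast hc0 N
    have hab : a N ≤ b N := by
      have := (hax N).trans (hxb N)
      rw [div_le_div_iff_of_pos_right hcN] at this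
      exact_mod_cast this
    rw [← sub_div, div_lt_div_iff₀ hcN (by positivity), one_mul] at hN
    have : (((b N - a N) * 2 ^ (n + 1) : ℕ) : ℝ) ≤ c N := by
      rw [Nat.cast_mul, Nat.cast_sub hab]; push_cast; linarith
    exact_mod_cast this
  have hcomp : Computable fun n => Nat.find (hex n) := by
    refine computable_nat_find ?_ hex
    have h1 : Computable fun x : ℕ × ℕ => (b x.2 - a x.2) * 2 ^ (x.1 + 1) :=
      Primrec.nat_mul.to_comp.comp
        (Primrec.nat_sub.to_comp.comp (hb.comp Computable.snd) (ha.comp Computable.snd))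
        (primrec_nat_pow.to_comp.comp (Computable.const 2) (Computable.succ.comp Computable.fst))
    exact Computable.of_eq (f := fun x : ℕ × ℕ =>
      decide ((b x.2 - a x.2) * 2 ^ (x.1 + 1) ≤ c x.2))
      (Primrec.nat_le.decide.to_comp.comp h1 (hc.comp Computable.snd)) fun x => by congr
  set M := fun n => Nat.find (hex n)
  refine ⟨fun n => (2 * (a (M n) * 2 ^ n) + c (M n)) / (2 * c (M n)), ?_, fun n => ?_⟩
  · have h2 : ∀ {g : ℕ → ℕ}, Computable g → Computable fun n => 2 * g n := fun hg =>
      Primrec.nat_mul.to_comp.comp (Computable.const 2) hg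
    exact Primrec.nat_div.to_comp.comp
      (Primrec.nat_add.to_comp.comp
        (h2 (Primrec.nat_mul.to_comp.comp (ha.comp hcomp)
          (primrec_nat_pow.to_comp.comp (Computable.const 2) Computable.id)))
        (hc.comp hcomp))
      (h2 (hc.comp hcomp))
  · have hM : (b (M n) - a (M n)) * 2 ^ (n + 1) ≤ c (M n) := Nat.find_spec (hex n)
    have hax := hax (M n)
    have hxb := hxb (M n)
    have hc0 := hc0 (M n)
    beta_reduce
    generalize a (M n) = a at *
    generalize b (M n) = b at *
    generalize c (M n) = c at *
    have hcr : (0 : ℝ) < c := by exact_mod_cast hc0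
    rw [div_le_iff₀ hcr] at hax
    rw [le_div_iff₀ hcr] at hxb
    have hM' : ((b : ℝ) - a) * 2 ^ (n + 1) ≤ c := by
      have h1 : (b : ℝ) - a ≤ ((b - a : ℕ) : ℝ) := by
        have : b ≤ (b - a) + a := by omega
        have : (b : ℝ) ≤ ((b - a : ℕ) : ℝ) + a := by exact_mod_cast this
        linarith
      calc _ ≤ ((b - a : ℕ) : ℝ) * 2 ^ (n + 1) := by gcongr
        _ ≤ c := by exact_mod_cast hM
    set q := (2 * (a * 2 ^ n) + c) / (2 * c) with hq
    have hq1 : q * (2 * c) ≤ 2 * (a * 2 ^ n) + c := Nat.div_mul_le_self _ _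
    have hq2 : 2 * (a * 2 ^ n) + c < (q + 1) * (2 * c) := by
      rw [mul_comm (q + 1)]; exact Nat.lt_mul_div_succ _ (by omega)
    have hq1' : (q : ℝ) * (2 * c) ≤ 2 * (a * 2 ^ n) + c := by exact_mod_cast hq1
    have hq2' : 2 * ((a : ℝ) * 2 ^ n) + c < (q + 1) * (2 * c) := by exact_mod_cast hq2
    have h2 : (0 : ℝ) < 2 ^ n := by positivity
    rw [pow_succ] at hM'
    have e : x - q / 2 ^ n = (x * 2 ^ n - q) / 2 ^ n := by field_simp
    suffices |x - q / 2 ^ n| ≤ 1 / 2 ^ n from this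
    rw [e, abs_div, abs_of_pos h2, div_le_div_iff_of_pos_right h2, abs_le]
    have h3 := mul_le_mul_of_nonneg_right hax h2.le
    have h4 := mul_le_mul_of_nonneg_right hxb h2.le
    constructor
    · refine le_of_mul_le_mul_right ?_ hcr
      nlinarith
    · refine le_of_mul_le_mul_right ?_ hcr
      nlinarith

theorem IsEnclosable.isComputableReal {x : ℝ} (hx : IsEnclosable x) : IsComputableReal x := by
  obtain ⟨f, hf, h⟩ := hx.exists_computable
  exact ⟨fun n => f n, primrec_int_ofNat.to_comp.comp hf, fun n => by simpa using h n⟩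

theorem IsEnclosable.isComputableReal_neg {x : ℝ} (hx : IsEnclosable x) :
    IsComputableReal (-x) := by
  obtain ⟨f, hf, h⟩ := hx.exists_computable
  refine ⟨fun n => -(f n : ℤ), primrec_int_neg_ofNat.to_comp.comp hf, fun n => ?_⟩
  rw [← abs_neg]
  convert! h n using 2
  push_cast; ring

theorem IsEnclosable.natCast (m : ℕ) : IsEnclosable m :=
  ⟨fun _ => m, fun _ => m, fun _ => 1, Computable.const _, Computable.const _, Computable.const _,
    by simp, by simp, by simp, by simp, by simp⟩

theorem IsEnclosable.natCast_mul {x : ℝ} (hx : IsEnclosable x) (m : ℕ) :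
    IsEnclosable (m * x) := by
  obtain ⟨a, b, c, ha, hb, hc, hc0, hax, hxb, hta, htb⟩ := hx
  have e : ∀ u v : ℕ, ((m * u : ℕ) : ℝ) / v = m * ((u : ℝ) / v) := fun u v => by
    push_cast; ring
  refine ⟨fun n => m * a n, fun n => m * b n, c,
    Primrec.nat_mul.to_comp.comp (Computable.const m) ha,
    Primrec.nat_mul.to_comp.comp (Computable.const m) hb, hc, hc0, fun n => ?_, fun n => ?_, ?_, ?_⟩
  · rw [e]; exact mul_le_mul_of_nonneg_left (hax n) (Nat.cast_nonneg m)
  · rw [e]; exact mul_le_mul_of_nonneg_left (hxb n) (Nat.cast_nonneg m)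
  · simp only [e]; exact hta.const_mul _
  · simp only [e]; exact htb.const_mul _

theorem IsEnclosable.isComputableReal_intCast_mul {x : ℝ} (hx : IsEnclosable x) (m : ℤ) :
    IsComputableReal (m * x) := by
  obtain ⟨n, rfl | rfl⟩ := m.eq_nat_or_neg
  · simpa using (hx.natCast_mul n).isComputableReal
  · simpa using (hx.natCast_mul n).isComputableReal_neg

theorem IsEnclosable.add {x y : ℝ} (hx : IsEnclosable x) (hy : IsEnclosable y) :
    IsEnclosable (x + y) := by
  obtain ⟨a, b, c, ha, hb, hc, hc0, hax, hxb, hta, htb⟩ := hx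
  obtain ⟨a', b', c', ha', hb', hc', hc0', hax', hxb', hta', htb'⟩ := hy
  have hm : ∀ {f g : ℕ → ℕ}, Computable f → Computable g → Computable fun n => f n * g n :=
    fun hf hg => Primrec.nat_mul.to_comp.comp hf hg
  have e : ∀ n (u v : ℕ), ((u * c' n + v * c n : ℕ) : ℝ) / ((c n * c' n : ℕ) : ℝ) =
      (u : ℝ) / c n + (v : ℝ) / c' n := fun n u v => by
    have h1 : (c n : ℝ) ≠ 0 := by exact_mod_cast (hc0 n).ne'
    have h2 : (c' n : ℝ) ≠ 0 := by exact_mod_cast (hc0' n).ne'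
    push_cast; field_simp
  refine ⟨fun n => a n * c' n + a' n * c n, fun n => b n * c' n + b' n * c n,
    fun n => c n * c' n, Primrec.nat_add.to_comp.comp (hm ha hc') (hm ha' hc),
    Primrec.nat_add.to_comp.comp (hm hb hc') (hm hb' hc), hm hc hc',
    fun n => Nat.mul_pos (hc0 n) (hc0' n), fun n => ?_, fun n => ?_, ?_, ?_⟩
  · rw [e]; exact add_le_add (hax n) (hax' n)
  · rw [e]; exact add_le_add (hxb n) (hxb' n)
  · simp only [e]; exact hta.add hta'
  · simp only [e]; exact htb.add htb'

theorem IsEnclosable.sum {ι : Type*} (s : Finset ι) {f : ι → ℝ}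
    (h : ∀ i ∈ s, IsEnclosable (f i)) : IsEnclosable (∑ i ∈ s, f i) := by
  classical
  induction s using Finset.induction_on with
  | empty => simpa using IsEnclosable.natCast 0
  | insert i s hi ih =>
    rw [Finset.sum_insert hi]
    exact (h i (Finset.mem_insert_self i s)).add
      (ih fun j hj => h j (Finset.mem_insert_of_mem hj))

theorem IsEnclosable.inv {x : ℝ} (hx : IsEnclosable x) (h0 : 0 < x) : IsEnclosable x⁻¹ := by
  obtain ⟨a, b, c, ha, hb, hc, hc0, hax, hxb, hta, htb⟩ := hx
  -- The lower bounds are positive only from some index on. That index is a fixed constant, so it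
  -- need not be computed.
  obtain ⟨N, hN⟩ := Filter.eventually_atTop.1 (hta.eventually_const_lt h0)
  have hs : Computable fun n : ℕ => n + N :=
    Primrec.nat_add.to_comp.comp Computable.id (Computable.const N)
  have hcr : ∀ n, (0 : ℝ) < c n := fun n => by exact_mod_cast hc0 n
  have har : ∀ n, (0 : ℝ) < a (n + N) := fun n => by
    have := hN (n + N) (by omega)
    exact (div_pos_iff_of_pos_right (hcr _)).1 this
  have hbr : ∀ n, (0 : ℝ) < b n := fun n =>
    (div_pos_iff_of_pos_right (hcr _)).1 (h0.trans_le (hxb n))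
  have e1 : ∀ n, ((c (n + N) * a (n + N) : ℕ) : ℝ) / ((a (n + N) * b (n + N) : ℕ) : ℝ) =
      ((b (n + N) : ℝ) / c (n + N))⁻¹ := fun n => by
    have := (har n).ne'
    have := (hbr (n + N)).ne'
    push_cast; field_simp
  have e2 : ∀ n, ((c (n + N) * b (n + N) : ℕ) : ℝ) / ((a (n + N) * b (n + N) : ℕ) : ℝ) =
      ((a (n + N) : ℝ) / c (n + N))⁻¹ := fun n => by
    have := (har n).ne'
    have := (hbr (n + N)).ne'
    push_cast; field_simp
  refine ⟨fun n => c (n + N) * a (n + N), fun n => c (n + N) * b (n + N),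
    fun n => a (n + N) * b (n + N), Primrec.nat_mul.to_comp.comp (hc.comp hs) (ha.comp hs),
    Primrec.nat_mul.to_comp.comp (hc.comp hs) (hb.comp hs),
    Primrec.nat_mul.to_comp.comp (ha.comp hs) (hb.comp hs),
    fun n => by
      have := mul_pos (har n) (hbr (n + N))
      exact_mod_cast this, fun n => ?_, fun n => ?_, ?_, ?_⟩
  · rw [e1]; exact inv_anti₀ h0 (hxb _)
  · rw [e2]; exact inv_anti₀ (div_pos (har n) (hcr _)) (hax _)
  · simp only [e1]
    exact (htb.comp (Filter.tendsto_add_atTop_nat N)).inv₀ h0.ne'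
  · simp only [e2]
    exact (hta.comp (Filter.tendsto_add_atTop_nat N)).inv₀ h0.ne'

/-- Raising to the power `d` makes comparison with a rational power of a fraction decidable in
natural numbers. -/
theorem le_mul_div_rpow_iff {m E A c s d : ℕ} (hc : 0 < c) (hd : 0 < d) :
    (m : ℝ) ≤ E * ((A : ℝ) / c) ^ ((s : ℝ) / d) ↔ m ^ d * c ^ s ≤ E ^ d * A ^ s := by
  have hcr : (0 : ℝ) < c := by exact_mod_cast hc
  have hdr : (d : ℝ) ≠ 0 := by exact_mod_cast hd.ne'
  rw [← pow_le_pow_iff_left₀ (Nat.cast_nonneg m) (by positivity) hd.ne', mul_pow,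
    ← Real.rpow_mul_natCast (by positivity), div_mul_cancel₀ _ hdr, Real.rpow_natCast, div_pow,
    ← mul_div_assoc, le_div_iff₀ (by positivity)]
  exact_mod_cast Iff.rfl

/-- As the base `A / c` is at least 1 and `s / d ≤ s`, the search may stop at `E * A ^ s`. -/
theorem findGreatest_eq_floor_rpow {E A c s d : ℕ} (hc : 0 < c) (hd : 0 < d) (hA : c ≤ A) :
    Nat.findGreatest (fun m => m ^ d * c ^ s ≤ E ^ d * A ^ s) (E * A ^ s) =
      ⌊(E : ℝ) * ((A : ℝ) / c) ^ ((s : ℝ) / d)⌋₊ := by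
  have hcr : (0 : ℝ) < c := by exact_mod_cast hc
  have hdr : (1 : ℝ) ≤ d := by exact_mod_cast hd
  rw [Nat.findGreatest_eq_iff]
  have h0 : (0 : ℝ) ≤ E * ((A : ℝ) / c) ^ ((s : ℝ) / d) := by positivity
  refine ⟨?_, fun _ => (le_mul_div_rpow_iff hc hd).1 (Nat.floor_le h0), fun {m} hm _ h => ?_⟩
  · refine Nat.floor_le_of_le ?_
    have h1 : (1 : ℝ) ≤ (A : ℝ) / c := by
      rw [one_le_div hcr]; exact_mod_cast hA
    push_cast
    calc (E : ℝ) * ((A : ℝ) / c) ^ ((s : ℝ) / d) ≤ E * ((A : ℝ) / c) ^ (s : ℝ) := by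
          have h2 : (s : ℝ) / d ≤ s := div_le_self (Nat.cast_nonneg s) hdr
          gcongr
      _ ≤ E * (A : ℝ) ^ s := by
          rw [Real.rpow_natCast]
          gcongr
          exact div_le_self (Nat.cast_nonneg A) (by exact_mod_cast hc)
  · exact absurd ((Nat.floor_lt h0).1 hm) (not_lt.2 ((le_mul_div_rpow_iff hc hd).2 h))

theorem computable_floor_rpow {A c s d : ℕ → ℕ} (hA : Computable A) (hc : Computable c)
    (hs : Computable s) (hd : Computable d) (hc0 : ∀ n, 0 < c n) (hd0 : ∀ n, 0 < d n)
    (hcA : ∀ n, c n ≤ A n) :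
    Computable fun n => ⌊((n + 1 : ℕ) : ℝ) * ((A n : ℝ) / c n) ^ ((s n : ℝ) / d n)⌋₊ := by
  have hprim : Primrec fun v : ℕ × ℕ × ℕ × ℕ × ℕ => Nat.findGreatest
      (fun m => m ^ v.2.2.2.2 * v.2.2.1 ^ v.2.2.2.1 ≤ v.1 ^ v.2.2.2.2 * v.2.1 ^ v.2.2.2.1)
      (v.1 * v.2.1 ^ v.2.2.2.1) := by
    have p1 : Primrec fun v : ℕ × ℕ × ℕ × ℕ × ℕ => v.1 := Primrec.fst
    have p2 : Primrec fun v : ℕ × ℕ × ℕ × ℕ × ℕ => v.2.1 := Primrec.fst.comp Primrec.snd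
    have p3 : Primrec fun v : ℕ × ℕ × ℕ × ℕ × ℕ => v.2.2.1 :=
      Primrec.fst.comp (Primrec.snd.comp Primrec.snd)
    have p4 : Primrec fun v : ℕ × ℕ × ℕ × ℕ × ℕ => v.2.2.2.1 :=
      Primrec.fst.comp (Primrec.snd.comp (Primrec.snd.comp Primrec.snd))
    have p5 : Primrec fun v : ℕ × ℕ × ℕ × ℕ × ℕ => v.2.2.2.2 :=
      Primrec.snd.comp (Primrec.snd.comp (Primrec.snd.comp Primrec.snd))
    refine Primrec.nat_findGreatest (Primrec.nat_mul.comp p1 (primrec_nat_pow.comp p2 p4)) ?_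
    exact Primrec.nat_le.comp
      (Primrec.nat_mul.comp
        (primrec_nat_pow.comp Primrec.snd (p5.comp Primrec.fst))
        (primrec_nat_pow.comp (p3.comp Primrec.fst) (p4.comp Primrec.fst)))
      (Primrec.nat_mul.comp
        (primrec_nat_pow.comp (p1.comp Primrec.fst) (p5.comp Primrec.fst))
        (primrec_nat_pow.comp (p2.comp Primrec.fst) (p4.comp Primrec.fst)))
  refine (hprim.to_comp.comp
    (Computable.succ.pair (hA.pair (hc.pair (hs.pair hd))))).of_eq fun n => ?_
  exact findGreatest_eq_floor_rpow (hc0 n) (hd0 n) (hcA n)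

open Filter Topology in
-- For bases at least 1 the power is monotone in both arguments, so lower and upper bounds combine
-- separately. Lower bounds of `x` are first raised to 1. At stage `n` the powers are rounded to
-- multiples of `1 / (n + 1)`.
theorem IsEnclosable.rpow {x s : ℝ} (hx : IsEnclosable x) (hs : IsEnclosable s) (hx1 : 1 ≤ x) :
    IsEnclosable (x ^ s) := by
  obtain ⟨a, b, c, ha, hb, hc, hc0, hax, hxb, hta, htb⟩ := hx
  obtain ⟨a', b', c', ha', hb', hc', hc0', hax', hxb', hta', htb'⟩ := hs
  have hcr : ∀ n, (0 : ℝ) < c n := fun n => by exact_mod_cast hc0 n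
  have hE : ∀ n : ℕ, (0 : ℝ) < ((n + 1 : ℕ) : ℝ) := fun n => by positivity
  have hmax : ∀ n, ((max (a n) (c n) : ℕ) : ℝ) / c n = max ((a n : ℝ) / c n) 1 := fun n => by
    rw [Nat.cast_max, ← max_div_div_right (hcr n).le, div_self (hcr n).ne']
  have hcb : ∀ n, c n ≤ b n := fun n => by
    have := hx1.trans (hxb n)
    rw [one_le_div (hcr n)] at this
    exact_mod_cast this
  have hinv : Tendsto (fun n : ℕ => 1 / (((n + 1 : ℕ) : ℝ))) atTop (𝓝 0) := by
    simpa using tendsto_one_div_add_atTop_nhds_zero_nat (𝕜 := ℝ)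
  set L := fun n => (((max (a n) (c n) : ℕ) : ℝ) / c n) ^ ((a' n : ℝ) / c' n) with hL
  set U := fun n => ((b n : ℝ) / c n) ^ ((b' n : ℝ) / c' n) with hU
  have hx0 : x ≠ 0 := by linarith
  have hLt : Tendsto L atTop (𝓝 (x ^ s)) := by
    refine Tendsto.rpow ?_ hta' (Or.inl hx0)
    simp only [hmax]
    simpa [hx1] using hta.max (tendsto_const_nhds (x := (1 : ℝ)))
  have hUt : Tendsto U atTop (𝓝 (x ^ s)) := htb.rpow htb' (Or.inl hx0)
  have hL0 : ∀ n, 0 ≤ L n := fun n => by positivity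
  have hU0 : ∀ n, 0 ≤ U n := fun n => by positivity
  have hLx : ∀ n, L n ≤ x ^ s := fun n => by
    calc L n ≤ x ^ ((a' n : ℝ) / c' n) := by
          refine Real.rpow_le_rpow (by positivity) ?_ (by positivity)
          rw [hmax]; exact max_le (hax n) hx1
      _ ≤ x ^ s := Real.rpow_le_rpow_of_exponent_le hx1 (hax' n)
  have hxU : ∀ n, x ^ s ≤ U n := fun n => by
    calc x ^ s ≤ x ^ ((b' n : ℝ) / c' n) := Real.rpow_le_rpow_of_exponent_le hx1 (hxb' n)
      _ ≤ U n := Real.rpow_le_rpow (by linarith) (hxb n) (by positivity)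
  have l1 : ∀ n, (⌊((n + 1 : ℕ) : ℝ) * L n⌋₊ : ℝ) / ((n + 1 : ℕ) : ℝ) ≤ L n := fun n => by
    rw [div_le_iff₀ (hE n), mul_comm (L n)]
    exact Nat.floor_le (mul_nonneg (Nat.cast_nonneg _) (hL0 n))
  have l2 : ∀ n, L n - 1 / ((n + 1 : ℕ) : ℝ) ≤
      (⌊((n + 1 : ℕ) : ℝ) * L n⌋₊ : ℝ) / ((n + 1 : ℕ) : ℝ) := fun n => by
    rw [le_div_iff₀ (hE n), sub_mul, div_mul_cancel₀ _ (hE n).ne', mul_comm]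
    linarith [Nat.lt_floor_add_one (((n + 1 : ℕ) : ℝ) * L n)]
  have u1 : ∀ n, U n ≤ ((⌊((n + 1 : ℕ) : ℝ) * U n⌋₊ + 1 : ℕ) : ℝ) / ((n + 1 : ℕ) : ℝ) :=
    fun n => by
    rw [le_div_iff₀ (hE n), mul_comm]
    push_cast
    have := Nat.lt_floor_add_one (((n + 1 : ℕ) : ℝ) * U n)
    push_cast at this
    linarith
  have u2 : ∀ n, ((⌊((n + 1 : ℕ) : ℝ) * U n⌋₊ + 1 : ℕ) : ℝ) / ((n + 1 : ℕ) : ℝ) ≤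
      U n + 1 / ((n + 1 : ℕ) : ℝ) := fun n => by
    rw [div_le_iff₀ (hE n), add_mul, div_mul_cancel₀ _ (hE n).ne', mul_comm (U n),
      Nat.cast_succ ⌊_⌋₊]
    linarith [Nat.floor_le (mul_nonneg (Nat.cast_nonneg (n + 1)) (hU0 n))]
  refine ⟨fun n => ⌊((n + 1 : ℕ) : ℝ) * L n⌋₊, fun n => ⌊((n + 1 : ℕ) : ℝ) * U n⌋₊ + 1,
    fun n => n + 1, ?_, ?_, Computable.succ, fun n => n.succ_pos, fun n => (l1 n).trans (hLx n),
    fun n => (hxU n).trans (u1 n), ?_, ?_⟩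
  · exact computable_floor_rpow (Primrec.nat_max.to_comp.comp ha hc) hc ha' hc' hc0 hc0'
      fun n => le_max_right _ _
  · exact Computable.succ.comp (computable_floor_rpow hb hc hb' hc' hc0 hc0' hcb)
  · exact tendsto_of_tendsto_of_tendsto_of_le_of_le (by simpa using hLt.sub hinv) hLt l2 l1
  · exact tendsto_of_tendsto_of_tendsto_of_le_of_le hUt (by simpa using hUt.add hinv) u1 u2

open Filter Topology in
theorem IsComputableReal.isEnclosable {x : ℝ} (hx : IsComputableReal x) (h1 : 1 ≤ x) :
    IsEnclosable x := by
  obtain ⟨f, hf, h⟩ := hx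
  have h2 : ∀ n : ℕ, (0 : ℝ) < 2 ^ n := fun n => by positivity
  have hfl : ∀ n, x * 2 ^ n ≤ f n + 1 ∧ (f n : ℝ) - 1 ≤ x * 2 ^ n := fun n => by
    have := h n
    have e : x - f n / 2 ^ n = (x * 2 ^ n - f n) / 2 ^ n := by
      have := (h2 n).ne'
      field_simp
    rw [e, abs_div, abs_of_pos (h2 n), div_le_div_iff_of_pos_right (h2 n), abs_le] at this
    constructor <;> linarith [this.1, this.2]
  have hf0 : ∀ n, 0 ≤ f n := fun n => by
    have h3 : (1 : ℝ) ≤ 2 ^ n := one_le_pow₀ one_le_two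
    have h4 : (-1 : ℝ) < f n := by nlinarith [(hfl n).1, h2 n]
    have : (-1 : ℤ) < f n := by exact_mod_cast h4
    omega
  have hT : ∀ n, ((f n).toNat : ℝ) = f n := fun n => by
    have := Int.toNat_of_nonneg (hf0 n)
    exact_mod_cast this
  have hinv : Tendsto (fun n : ℕ => (2 : ℝ) / 2 ^ n) atTop (𝓝 0) :=
    tendsto_const_nhds.div_atTop (tendsto_pow_atTop_atTop_of_one_lt one_lt_two)
  have htn : Computable fun n => (f n).toNat := primrec_int_toNat.to_comp.comp hf
  have hsub : ∀ n, (((f n).toNat - 1 : ℕ) : ℝ) ≤ x * 2 ^ n := fun n => by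
    rcases Nat.eq_zero_or_pos (f n).toNat with h | h
    · rw [h]; simp only [Nat.zero_sub, Nat.cast_zero]
      exact mul_nonneg (by linarith) (h2 n).le
    · rw [Nat.cast_sub h, hT, Nat.cast_one]; exact (hfl n).2
  have hsub' : ∀ n, x * 2 ^ n - 2 ≤ (((f n).toNat - 1 : ℕ) : ℝ) := fun n => by
    have : ((f n).toNat : ℝ) ≤ (((f n).toNat - 1 : ℕ) : ℝ) + 1 := by
      exact_mod_cast (by omega)
    rw [hT] at this
    linarith [(hfl n).1]
  have hadd : ∀ n, (((f n).toNat + 1 : ℕ) : ℝ) = f n + 1 := fun n => by push_cast; rw [hT]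
  refine ⟨fun n => (f n).toNat - 1, fun n => (f n).toNat + 1, fun n => 2 ^ n,
    Primrec.nat_sub.to_comp.comp htn (Computable.const 1), Computable.succ.comp htn,
    primrec_nat_pow.to_comp.comp (Computable.const 2) Computable.id, fun n => by positivity,
    fun n => ?_, fun n => ?_, ?_, ?_⟩
  · push_cast; rw [div_le_iff₀ (h2 n)]; exact_mod_cast hsub n
  · rw [hadd]; push_cast; rw [le_div_iff₀ (h2 n)]; exact (hfl n).1
  · refine tendsto_of_tendsto_of_tendsto_of_le_of_le (g := fun n => x - 2 / 2 ^ n)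
      (h := fun _ => x) (by simpa using tendsto_const_nhds.sub hinv) tendsto_const_nhds
      (fun n => ?_) fun n => ?_
    · simp only [Nat.cast_pow, Nat.cast_ofNat]
      rw [le_div_iff₀ (h2 n), sub_mul, div_mul_cancel₀ _ (h2 n).ne']; exact hsub' n
    · simp only [Nat.cast_pow, Nat.cast_ofNat]
      rw [div_le_iff₀ (h2 n)]; exact hsub n
  · refine tendsto_of_tendsto_of_tendsto_of_le_of_le (g := fun _ => x)
      (h := fun n => x + 2 / 2 ^ n) tendsto_const_nhds (by simpa using tendsto_const_nhds.add hinv)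
      (fun n => ?_) fun n => ?_
    · simp only [Nat.cast_pow, Nat.cast_ofNat, hadd]
      rw [le_div_iff₀ (h2 n)]; exact (hfl n).1
    · simp only [Nat.cast_pow, Nat.cast_ofNat, hadd]
      rw [div_le_iff₀ (h2 n), add_mul, div_mul_cancel₀ _ (h2 n).ne']; linarith [(hfl n).2]

theorem isComputableReal_intCast_mul_sum_rpow {ι : Type*} [Fintype ι] {p : ℝ} (hp : 1 ≤ p)
    (hcp : IsComputableReal p) {N : ι → ℕ} (hN : ∃ i, N i ≠ 0) (m : ℤ) :
    IsComputableReal (m * ((∑ i, (N i : ℝ) ^ p) ^ (1 / p))⁻¹) := by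
  have hp0 : 0 < p := by linarith
  have hpe := hcp.isEnclosable hp
  have h1 : ∀ i, N i ≠ 0 → (1 : ℝ) ≤ (N i : ℝ) := fun i hi => by
    exact_mod_cast Nat.one_le_iff_ne_zero.2 hi
  have hsum : 1 ≤ ∑ i, (N i : ℝ) ^ p := by
    obtain ⟨i, hi⟩ := hN
    calc (1 : ℝ) ≤ (N i : ℝ) ^ p := Real.one_le_rpow (h1 i hi) hp0.le
      _ ≤ _ := Finset.single_le_sum (f := fun i => (N i : ℝ) ^ p) (fun j _ => by positivity)
        (Finset.mem_univ i)
  refine IsEnclosable.isComputableReal_intCast_mul (IsEnclosable.inv ?_ (by positivity)) m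
  refine IsEnclosable.rpow (IsEnclosable.sum _ fun i _ => ?_) ?_ hsum
  -- Closure under powers needs a base at least 1, so zero terms are treated apart.
  · by_cases hi : N i = 0
    · simpa [hi, hp0.ne'] using IsEnclosable.natCast 0
    · exact (IsEnclosable.natCast _).rpow hpe (h1 i hi)
  · rw [one_div]; exact hpe.inv hp0

/-! ### Norms, rank and half-moments -/

theorem lpNorm_ofReal {ι : Type*} [Fintype ι] {p : ℝ} (hp : 1 ≤ p) (v : ι → ℝ) :
    lpNorm (ENNReal.ofReal p) v = (∑ i, |v i| ^ p) ^ (1 / p) := by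
  have h : (ENNReal.ofReal p).toReal = p := ENNReal.toReal_ofReal (by linarith)
  rw [lpNorm, PiLp.norm_eq_sum (by rw [h]; linarith), h]
  rfl

theorem lpNorm_smul_sub {ι : Type*} [Fintype ι] {k : ℕ} {p : ℝ} (hp : 1 ≤ p) {c : ℝ}
    (hc : 0 ≤ c) (V : Matrix ι (Fin k) ℝ) (t : ι → ℝ) (x : Fin k → ℝ) :
    lpNorm (ENNReal.ofReal p) ((c • V) *ᵥ x - c • t) =
      c * (∑ i, |(V *ᵥ x - t) i| ^ p) ^ (1 / p) := by
  have : Fact (1 ≤ ENNReal.ofReal p) := ⟨by rwa [ENNReal.one_le_ofReal]⟩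
  rw [← lpNorm_ofReal hp, Matrix.smul_mulVec, ← smul_sub, lpNorm, lpNorm, WithLp.toLp_smul,
    norm_smul, Real.norm_of_nonneg hc]

theorem rank_eq_of_mulVec_injective {ι : Type*} {k : ℕ} {V : Matrix ι (Fin k) ℝ}
    (h : ∀ v, V *ᵥ v = 0 → v = 0) : V.rank = k := by
  have hinj : Function.Injective V.mulVecLin :=
    (injective_iff_map_eq_zero V.mulVecLin).2 fun v hv => h v hv
  rw [Matrix.rank, LinearMap.finrank_range_of_inj hinj, Module.finrank_fin_fun]

theorem one_add_le_inv_mul_rpow {p S U g : ℝ} (hp : 0 < p) (hS : 0 < S) (hg : 0 ≤ g)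
    (h : (1 + g) ^ p * S ≤ U) : 1 + g ≤ (S ^ (1 / p))⁻¹ * U ^ (1 / p) := by
  have hS' : 0 < S ^ (1 / p) := Real.rpow_pos_of_pos hS _
  rw [inv_mul_eq_div, le_div_iff₀ hS']
  calc (1 + g) * S ^ (1 / p) = ((1 + g) ^ p * S) ^ (1 / p) := by
        rw [Real.mul_rpow (by positivity) hS.le, ← Real.rpow_mul (by linarith),
          mul_one_div_cancel hp.ne', Real.rpow_one]
    _ ≤ _ := by gcongr

/-- The part of the absolute moment of the cube form over the vectors with coordinate
product `s`. -/
noncomputable def cubeHalfMoment (k : ℕ) (p : ℝ) (s : ℤˣ) : ℝ :=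
  ∑ u : Fin k → ℤˣ, if ∏ i, u i = s then |cubeForm k u| ^ p else 0

theorem two_mul_ite_units_eq (v s : ℤˣ) (x : ℝ) :
    2 * (if v = s then x else 0) = x + (((s : ℤ) : ℝ)) * (((v : ℤ) : ℝ) * x) := by
  rcases Int.units_eq_one_or v with rfl | rfl <;> rcases Int.units_eq_one_or s with rfl | rfl <;>
    simp <;> ring

theorem coe_prod_units {k : ℕ} (u : Fin k → ℤˣ) :
    (((∏ i, u i : ℤˣ) : ℤ) : ℝ) = ∏ i, (((u i : ℤˣ) : ℤ) : ℝ) := by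
  push_cast; rfl

theorem two_mul_sum_ite_prod {k : ℕ} (s : ℤˣ) (g : (Fin k → ℤˣ) → ℝ) :
    2 * ∑ u : Fin k → ℤˣ, (if ∏ i, u i = s then g u else 0) =
      ∑ u, g u + ((s : ℤ) : ℝ) * ∑ u, (∏ i, (((u i : ℤˣ) : ℤ) : ℝ)) * g u := by
  rw [Finset.mul_sum, Finset.mul_sum, ← Finset.sum_add_distrib]
  exact Finset.sum_congr rfl fun u _ => by rw [two_mul_ite_units_eq, coe_prod_units]

/-- The sign of the constraint-independent part of the parity weight. -/
noncomputable def paritySign (k : ℕ) (p : ℝ) : ℤˣ := (-1) ^ (k / 2 + ⌊p / 2⌋₊)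

theorem two_mul_cubeHalfMoment_paritySign (k : ℕ) (p : ℝ) :
    2 * cubeHalfMoment k p (paritySign k p) = cubeMoment k p - cubeSignedMoment k p := by
  rw [cubeHalfMoment, two_mul_sum_ite_prod, cubeMoment, cubeSignedMoment, paritySign, pow_succ]
  push_cast; ring

theorem two_mul_cubeHalfMoment_neg_paritySign (k : ℕ) (p : ℝ) :
    2 * cubeHalfMoment k p (-paritySign k p) = cubeMoment k p + cubeSignedMoment k p := by
  rw [cubeHalfMoment, two_mul_sum_ite_prod, cubeMoment, cubeSignedMoment, paritySign, pow_succ]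
  push_cast; ring

theorem one_add_parityGap_rpow_mul_cubeHalfMoment_le {k : ℕ} (hk : 3 ≤ k) {p : ℝ} (hp : 1 ≤ p)
    (hpk : p < k) :
    (1 + parityGap k p) ^ p * cubeHalfMoment k p (paritySign k p) ≤
      cubeHalfMoment k p (-paritySign k p) := by
  have h := one_add_parityGap_rpow_mul_le hk hp hpk
  rw [← two_mul_cubeHalfMoment_paritySign, ← two_mul_cubeHalfMoment_neg_paritySign] at h
  linarith

/-- Since `2 < k`, the signed second moment vanishes, so each half of the cube carries exactly half
of the positive second moment. -/
theorem exists_cubeForm_ne_zero {k : ℕ} (hk : 3 ≤ k) (s : ℤˣ) :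
    ∃ u : Fin k → ℤˣ, ∏ i, u i = s ∧ cubeForm k u ≠ 0 := by
  by_contra! hcon
  have h := two_mul_sum_ite_prod (k := k) s fun u => cubeForm k u ^ 2
  rw [sum_prod_mul_cubeForm_pow (by omega : 2 < k), mul_zero, add_zero,
    Finset.sum_eq_zero (fun u _ => by
      split_ifs with hu
      · rw [hcon u hu, sq, mul_zero]
      · rfl), mul_zero] at h
  have h2 := cubeMoment_pos hk (2 : ℝ)
  rw [cubeMoment] at h2
  simp only [Real.rpow_ofNat, sq_abs] at h2
  exact h2.ne h

theorem cubeHalfMoment_pos {k : ℕ} (hk : 3 ≤ k) (p : ℝ) (s : ℤˣ) : 0 < cubeHalfMoment k p s := by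
  obtain ⟨u, hu, h0⟩ := exists_cubeForm_ne_zero hk s
  refine Finset.sum_pos' (fun u _ => by positivity) ⟨u, Finset.mem_univ _, ?_⟩
  rw [if_pos hu]
  exact Real.rpow_pos_of_pos (abs_pos.2 h0) p

/-! ### The isolating parallelepiped in integer form -/

theorem parityShift_eq_cast (k : ℕ) : parityShift k = ((k % 2 : ℕ) : ℝ) := by
  rcases Nat.even_or_odd' k with ⟨m, rfl | rfl⟩
  · rw [parityShift_two_mul]; simp
  · rw [parityShift_two_mul_add_one]; simp [Nat.add_mod]

/-- The absolute value of the cube form on vectors of coordinate product `s`, and zero elsewhere. -/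
def cubeFormNat (k : ℕ) (s : ℤˣ) (u : Fin k → ℤˣ) : ℕ :=
  if ∏ i, u i = s then (∑ i, (u i : ℤ) - (k % 2 : ℕ)).natAbs else 0

theorem cubeFormNat_rpow {k : ℕ} {p : ℝ} (hp : 0 < p) (s : ℤˣ) (u : Fin k → ℤˣ) :
    (cubeFormNat k s u : ℝ) ^ p = if ∏ i, u i = s then |cubeForm k u| ^ p else 0 := by
  rw [cubeFormNat, cubeForm, parityShift_eq_cast]
  split_ifs
  · rw [Nat.cast_natAbs]; push_cast; rfl
  · rw [Nat.cast_zero, Real.zero_rpow hp.ne']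

theorem exists_cubeFormNat_ne_zero {k : ℕ} (hk : 3 ≤ k) (s : ℤˣ) :
    ∃ u, cubeFormNat k s u ≠ 0 := by
  obtain ⟨u, hu, h0⟩ := exists_cubeForm_ne_zero hk s
  refine ⟨u, fun h => h0 ?_⟩
  have := cubeFormNat_rpow zero_lt_one s u
  rw [h, if_pos hu] at this
  simpa using this.symm

/-- The integer matrix with rows `-2 u` where `∏ u = s`, and zero rows elsewhere. -/
def parityIntMatrix (k : ℕ) (s : ℤˣ) : Matrix (Fin k → ℤˣ) (Fin k) ℤ :=
  Matrix.of fun u i => if ∏ j, u j = s then -2 * (u i : ℤ) else 0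

/-- The target vector matching `parityIntMatrix`. -/
def parityIntTarget (k : ℕ) (s : ℤˣ) (u : Fin k → ℤˣ) : ℤ :=
  if ∏ j, u j = s then (k % 2 : ℕ) - ∑ i, (u i : ℤ) else 0

theorem parityIntMatrix_mulVec_sub {k : ℕ} (s : ℤˣ) (z : Fin k → ℝ) (u : Fin k → ℤˣ) :
    ∑ i, (parityIntMatrix k s u i : ℝ) * z i - parityIntTarget k s u =
      if ∏ j, u j = s then ∑ i, (((u i : ℤˣ) : ℤ) : ℝ) * (1 - 2 * z i) - parityShift k else 0 := by
  simp only [parityIntMatrix, parityIntTarget, Matrix.of_apply, parityShift_eq_cast]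
  split_ifs
  · rw [Int.cast_sub, Int.cast_natCast]
    push_cast
    simp only [mul_sub, mul_one, Finset.sum_sub_distrib]
    have : ∀ i, -2 * (((u i : ℤˣ) : ℤ) : ℝ) * z i = -((((u i : ℤˣ) : ℤ) : ℝ) * (2 * z i)) :=
      fun i => by ring
    simp only [this, Finset.sum_neg_distrib]
    ring
  · simp

/-- The vector of signs of a Boolean assignment. -/
def boolSign {k : ℕ} (x : Fin k → Bool) (i : Fin k) : ℤˣ := if x i then -1 else 1

theorem one_sub_two_mul_boolVec {k : ℕ} (x : Fin k → Bool) (i : Fin k) :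
    1 - 2 * boolVec x i = (((boolSign x i : ℤˣ) : ℤ) : ℝ) := by
  unfold boolVec boolSign
  split_ifs <;> norm_num

theorem prod_boolSign {k : ℕ} (x : Fin k → Bool) :
    ∏ i, boolSign x i = (-1) ^ ((List.ofFn x).foldr xor false).toNat := by
  induction k with
  | zero => simp
  | succ k ih =>
    rw [Fin.prod_univ_succ, List.ofFn_succ, List.foldr_cons,
      show ∏ i : Fin k, boolSign x i.succ = _ from ih fun i => x i.succ]
    unfold boolSign
    generalize (List.ofFn fun i : Fin k => x i.succ).foldr xor false = c
    cases x 0 <;> cases c <;> simp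

theorem paritySign_mul_prod_boolSign {k : ℕ} (p : ℝ) (b : Bool) (x : Fin k → Bool) :
    paritySign k p * (-1) ^ b.toNat * ∏ i, boolSign x i =
      if parityConstraint k b x then paritySign k p else -paritySign k p := by
  rw [prod_boolSign, parityConstraint]
  generalize (List.ofFn x).foldr xor false = c
  cases b <;> cases c <;> simp

theorem sum_abs_parityInt_boolVec {k : ℕ} {p : ℝ} (hp : 0 < p) (s : ℤˣ) (x : Fin k → Bool) :
    ∑ u, |∑ i, (parityIntMatrix k s u i : ℝ) * boolVec x i - parityIntTarget k s u| ^ p =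
      cubeHalfMoment k p (s * ∏ i, boolSign x i) := by
  -- Replacing `u` by its coordinatewise product with the sign vector absorbs the assignment, which
  -- survives only in the product condition.
  refine Fintype.sum_equiv (Equiv.mulRight (boolSign x)) _ _ fun u => ?_
  rw [parityIntMatrix_mulVec_sub]
  simp only [one_sub_two_mul_boolVec, Equiv.coe_mulRight, Pi.mul_apply, Finset.prod_mul_distrib,
    mul_left_inj, cubeForm]
  split_ifs
  · push_cast; rfl
  · rw [abs_zero, Real.zero_rpow hp.ne']

/-- The signed second moment of the linear form given by `v` is zero because `2 < k`. Vanishing on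
half of the cube therefore forces vanishing on all of it, and flipping one coordinate isolates `v
j`. -/
theorem eq_zero_of_parityIntMatrix_mulVec {k : ℕ} (hk : 3 ≤ k) (s : ℤˣ) {v : Fin k → ℝ}
    (h : ∀ u, ∑ i, (parityIntMatrix k s u i : ℝ) * v i = 0) : v = 0 := by
  have h0 : ∀ u : Fin k → ℤˣ, ∏ j, u j = s →
      (0 + ∑ i, v i * (((u i : ℤˣ) : ℤ) : ℝ)) = 0 := fun u hu => by
    have := h u
    simp only [parityIntMatrix, Matrix.of_apply, if_pos hu] at this
    have e : ∑ i, ((-2 * (u i : ℤ) : ℤ) : ℝ) * v i =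
        -2 * ∑ i, v i * (((u i : ℤˣ) : ℤ) : ℝ) := by
      rw [Finset.mul_sum]
      exact Finset.sum_congr rfl fun i _ => by push_cast; ring
    rw [e] at this
    linarith
  have h1 := two_mul_sum_ite_prod s
    fun u : Fin k → ℤˣ => (0 + ∑ i, v i * (((u i : ℤˣ) : ℤ) : ℝ)) ^ 2
  rw [sum_prod_mul_affine_pow v 0 (by omega : 2 < k), mul_zero, add_zero,
    Finset.sum_eq_zero (fun u _ => by
      split_ifs with hu
      · rw [h0 u hu, sq, mul_zero]
      · rfl), mul_zero] at h1
  have h2 : ∀ u : Fin k → ℤˣ, ∑ i, v i * (((u i : ℤˣ) : ℤ) : ℝ) = 0 := fun u => by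
    have := (Finset.sum_eq_zero_iff_of_nonneg (fun u _ => sq_nonneg _)).1 h1.symm u
      (Finset.mem_univ u)
    simpa using this
  funext j
  have h3 := h2 1
  have h4 := h2 (Function.update 1 j (-1))
  rw [← Finset.add_sum_erase _ _ (Finset.mem_univ j)] at h3 h4
  have h5 : ∑ i ∈ Finset.univ.erase j, v i *
        (((Function.update (1 : Fin k → ℤˣ) j (-1) i : ℤˣ) : ℤ) : ℝ) =
      ∑ i ∈ Finset.univ.erase j, v i * ((((1 : Fin k → ℤˣ) i : ℤˣ) : ℤ) : ℝ) :=
    Finset.sum_congr rfl fun i hi => by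
      rw [Function.update_of_ne (Finset.ne_of_mem_erase hi)]
  rw [h5, Function.update_self] at h4
  simp only [Pi.one_apply, Units.val_one, Int.cast_one, mul_one, Units.val_neg, Int.cast_neg,
    mul_neg] at h3 h4
  simp only [Pi.zero_apply]
  linarith

theorem parityWeight_rpow {k : ℕ} {p : ℝ} (hp : 0 < p) (b : Bool) (u : Fin k → ℤˣ) :
    parityWeight k p b u ^ (1 / p) =
      if ∏ i, u i = paritySign k p * (-1) ^ b.toNat then (2 : ℝ) ^ (1 / p) else 0 := by
  have h := two_mul_ite_units_eq (∏ i, u i) (paritySign k p * (-1) ^ b.toNat) 1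
  have e : parityWeight k p b u =
      2 * (if ∏ i, u i = paritySign k p * (-1) ^ b.toNat then 1 else 0) := by
    rw [h, parityWeight, paritySign, ← pow_add, coe_prod_units]
    push_cast; ring
  rw [e]
  split_ifs
  · rw [mul_one]
  · rw [mul_zero, Real.zero_rpow (by positivity)]

theorem exists_parity_isolatingParallelepiped {k : ℕ} (hk : 3 ≤ k) {p : ℝ} (hp : 1 ≤ p)
    (hpk : p < k) (b : Bool) :
    ∃ ε c : ℝ, parityGap k p ≤ ε ∧ 0 < c ∧
      IsIsolatingParallelepiped (ENNReal.ofReal p) (parityConstraint k b) ε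
        (c • toBoolMatrix (paramMatrix p (parityWeight k p b)))
        (c • toBoolTarget (paramMatrix p (parityWeight k p b))
          (paramTarget p (parityWeight k p b) (parityShift k))) ∧
      (IsComputableReal p →
        HasComputableEntries
          (c • toBoolMatrix (paramMatrix p (parityWeight k p b)))
          (c • toBoolTarget (paramMatrix p (parityWeight k p b))
            (paramTarget p (parityWeight k p b) (parityShift k)))) := by
  have hp0 : 0 < p := by linarith
  set s := paritySign k p * (-1) ^ b.toNat with hs
  set S := cubeHalfMoment k p (paritySign k p) with hSdef
  set U := cubeHalfMoment k p (-paritySign k p)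
  have hS : 0 < S := cubeHalfMoment_pos hk p _
  set Z := (S ^ (1 / p))⁻¹ with hZ
  have hZ0 : 0 < Z := inv_pos.2 (Real.rpow_pos_of_pos hS _)
  have h2 : (0 : ℝ) < 2 ^ (1 / p) := by positivity
  have hV : (Z / 2 ^ (1 / p)) • toBoolMatrix (paramMatrix p (parityWeight k p b)) =
      Z • (parityIntMatrix k s).map (fun m : ℤ => (m : ℝ)) := by
    ext u i
    simp only [toBoolMatrix, paramMatrix, Matrix.smul_apply, Matrix.of_apply, smul_eq_mul,
      Matrix.map_apply, parityIntMatrix, parityWeight_rpow hp0, ← hs]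
    split_ifs
    · push_cast; field_simp
    · simp
  have ht : (Z / 2 ^ (1 / p)) • toBoolTarget (paramMatrix p (parityWeight k p b))
      (paramTarget p (parityWeight k p b) (parityShift k)) =
      Z • fun u => (parityIntTarget k s u : ℝ) := by
    ext u
    simp only [toBoolTarget, paramMatrix, paramTarget, Pi.smul_apply, Pi.sub_apply,
      Matrix.mulVec, dotProduct, Pi.one_apply, mul_one, smul_eq_mul, Matrix.of_apply,
      parityIntTarget, parityWeight_rpow hp0, ← hs, ← Finset.mul_sum, parityShift_eq_cast]
    split_ifs
    · rw [Int.cast_sub, Int.cast_natCast]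
      push_cast; field_simp
    · simp
  have hnorm : ∀ x : Fin k → Bool, lpNorm (ENNReal.ofReal p)
      ((Z • (parityIntMatrix k s).map (fun m : ℤ => (m : ℝ))) *ᵥ boolVec x -
        Z • fun u => (parityIntTarget k s u : ℝ)) =
      Z * (if parityConstraint k b x then S else U) ^ (1 / p) := fun x => by
    rw [lpNorm_smul_sub hp hZ0.le]
    simp only [Pi.sub_apply, Matrix.mulVec, dotProduct, Matrix.map_apply]
    rw [sum_abs_parityInt_boolVec hp0, hs, paritySign_mul_prod_boolSign, apply_ite (cubeHalfMoment k p)]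
  have hgap := one_add_le_inv_mul_rpow hp0 hS (parityGap_nonneg k hp0.le)
    (one_add_parityGap_rpow_mul_cubeHalfMoment_le hk hp hpk)
  -- The exact gap is `(U / S) ^ (1 / p) - 1`. The scale removes the factor `2 ^ (1 / p)` of the
  -- nonzero weights and normalises the satisfying distance to 1.
  refine ⟨Z * U ^ (1 / p) - 1, Z / 2 ^ (1 / p), by linarith, by positivity, ?_, fun hcp => ?_⟩
  · rw [hV, ht]
    refine ⟨by linarith [parityGap_nonneg k hp0.le], ?_, fun x hx => ?_, fun x hx => ?_⟩
    · refine rank_eq_of_mulVec_injective fun v hv =>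
        eq_zero_of_parityIntMatrix_mulVec hk s fun u => ?_
      rw [Matrix.smul_mulVec, smul_eq_zero_iff_right hZ0.ne'] at hv
      exact congrFun hv u
    · rw [hnorm, if_pos hx]
      exact inv_mul_cancel₀ (Real.rpow_pos_of_pos hS _).ne'
    · rw [hnorm, hx]
      simp
  · rw [hV, ht]
    have hcomp : ∀ m : ℤ, IsComputableReal (Z * m) := fun m => by
      rw [mul_comm, hZ, hSdef, cubeHalfMoment]
      simp only [← cubeFormNat_rpow hp0]
      exact isComputableReal_intCast_mul_sum_rpow hp hcp (exists_cubeFormNat_ne_zero hk _) m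
    exact ⟨fun u i => hcomp _, fun u => hcomp _⟩

/-! ### The isolating lattice -/

theorem IsIsolatingLattice.reindex {ι ι' : Type*} [Fintype ι] [Fintype ι'] {k : ℕ} {p : ℝ}
    (hp : 1 ≤ p) {C : (Fin k → Bool) → Bool} {ε : ℝ} {V : Matrix ι (Fin k) ℝ} {t : ι → ℝ}
    (h : IsIsolatingLattice (ENNReal.ofReal p) C ε V t) (e : ι' ≃ ι) :
    IsIsolatingLattice (ENNReal.ofReal p) C ε (V.submatrix e id) (t ∘ e) := by
  have hn : ∀ x, lpNorm (ENNReal.ofReal p) (V.submatrix e id *ᵥ x - t ∘ e) =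
      lpNorm (ENNReal.ofReal p) (V *ᵥ x - t) := fun x => by
    rw [lpNorm_ofReal hp, lpNorm_ofReal hp,
      ← e.sum_comp fun i => |(V *ᵥ x - t) i| ^ p]
    rfl
  refine ⟨⟨h.eps_nonneg, ?_, fun x hx => ?_, fun x hx => ?_⟩, fun x hx => ?_⟩
  · have h1 : (V.submatrix e id).mulVecLin =
        (LinearEquiv.funCongrLeft ℝ ℝ e).toLinearMap ∘ₗ V.mulVecLin := by
      ext; rfl
    rw [Matrix.rank, h1, LinearMap.range_comp]
    exact (LinearEquiv.finrank_map_eq _ _).trans h.full_rank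
  · rw [hn]; exact h.sat x hx
  · rw [hn]; exact h.unsat x hx
  · rw [hn]; exact h.nonbool x hx

/-- Here `p δ ≤ 1/2`, and `exp (1/2) < 2`. This leaves room to choose a rational weight for the
extra block. -/
theorem one_add_parityGap_rpow_lt_two {k : ℕ} {p : ℝ} (hp : 1 ≤ p) (hpk : p < k) :
    (1 + parityGap k p) ^ p < 2 := by
  have hp0 : 0 < p := by linarith
  have hk0 : (0 : ℝ) < k := by linarith
  have he := Real.exp_one_gt_d9
  have hpi := Real.pi_gt_three
  have hbase : 2 * p / (Real.exp 1 ^ 2 * Real.pi ^ 2 * k) ≤ 1 / 2 := by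
    rw [div_le_iff₀ (by positivity)]
    have h1 : (4 : ℝ) ≤ Real.exp 1 ^ 2 * Real.pi ^ 2 := by
      calc (4 : ℝ) = 2 ^ 2 * 1 ^ 2 := by norm_num
        _ ≤ _ := by gcongr <;> linarith
    nlinarith
  have hpow : (2 * p / (Real.exp 1 ^ 2 * Real.pi ^ 2 * k)) ^ ((p + 1) / 2) ≤ 1 / 2 := by
    calc _ ≤ (2 * p / (Real.exp 1 ^ 2 * Real.pi ^ 2 * k)) ^ (1 : ℝ) :=
          Real.rpow_le_rpow_of_exponent_ge (by positivity) (by linarith) (by linarith)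
      _ ≤ 1 / 2 := by rw [Real.rpow_one]; exact hbase
  have hg : parityGap k p * p ≤ 1 / 2 := by
    have h1 : |Real.sin (Real.pi * p / 2)| / p ^ 2 * p ≤ 1 := by
      rw [sq, ← div_div, div_mul_cancel₀ _ hp0.ne', div_le_one hp0]
      exact (Real.abs_sin_le_one _).trans hp
    calc parityGap k p * p = |Real.sin (Real.pi * p / 2)| / p ^ 2 * p *
          (2 * p / (Real.exp 1 ^ 2 * Real.pi ^ 2 * k)) ^ ((p + 1) / 2) := by
          unfold parityGap; ring
      _ ≤ 1 * (1 / 2) := by gcongr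
      _ = 1 / 2 := one_mul _
  have hg0 := parityGap_nonneg k hp0.le
  calc (1 + parityGap k p) ^ p ≤ Real.exp (parityGap k p) ^ p := by
        gcongr
        linarith [Real.add_one_le_exp (parityGap k p)]
    _ = Real.exp (parityGap k p * p) := (Real.exp_mul _ _).symm
    _ ≤ Real.exp (1 / 2) := Real.exp_le_exp.2 hg
    _ < 2 := by
        rw [← Real.lt_log_iff_exp_lt two_pos]
        linarith [Real.log_two_gt_d9]

/-- Weight of the additional identity block of the lattice: it pushes nonboolean vectors away and
costs only a factor `1 / (1 + 2 K)` of the gap. -/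
theorem one_add_mul_rpow_mul_add_le {p g S U K Y : ℝ} (hp : 1 ≤ p) (hg : 0 ≤ g) (hS : 0 < S)
    (hK : 0 ≤ K) (hSU : (1 + g) ^ p * S ≤ U) (hY : Y ≤ 2 * (K * U) / (1 + g) ^ p) :
    (1 + g * (1 / (1 + 2 * K))) ^ p * (S + Y) ≤ U + Y := by
  set E := (1 + g) ^ p with hE
  have hE1 : 1 ≤ E := Real.one_le_rpow (by linarith) (by linarith)
  set θ := 1 / (1 + 2 * K) with hθ
  have hθ0 : 0 < θ := by positivity
  have hθK : θ * (1 + 2 * K) = 1 := by rw [hθ]; field_simp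
  have hθ1 : θ ≤ 1 := by nlinarith
  -- By convexity the power lies below its chord between `1` and `1 + g`.
  have hconv : (1 + g * θ) ^ p ≤ 1 + θ * (E - 1) := by
    have h := (convexOn_rpow hp).2 (Set.mem_Ici.2 zero_le_one)
      (Set.mem_Ici.2 (by linarith : 0 ≤ 1 + g)) (show 0 ≤ 1 - θ by linarith)
      hθ0.le (by ring)
    simp only [smul_eq_mul, Real.one_rpow, mul_one] at h
    rw [← hE] at h
    have e : 1 - θ + θ * (1 + g) = 1 + g * θ := by ring
    rw [e] at h
    linarith
  rcases le_total (S + Y) 0 with hneg | hpos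
  · have h1 : 1 ≤ (1 + g * θ) ^ p := Real.one_le_rpow (by nlinarith) (by linarith)
    nlinarith
  have hY' : Y * E ≤ 2 * (K * U) := by rwa [le_div_iff₀ (by linarith)] at hY
  have hmain : θ * (E - 1) * (S + Y) ≤ U - S := by
    refine le_of_mul_le_mul_right ?_ (by linarith : 0 < E)
    have h1 : θ * (E - 1) * (S + Y) * E ≤ θ * (E - 1) * (S * E + 2 * (K * U)) := by
      have : 0 ≤ θ * (E - 1) := mul_nonneg hθ0.le (by linarith)
      nlinarith
    have h2 : θ * (E - 1) * (S * E + 2 * (K * U)) =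
        (E - 1) * (θ * (S * E) + (1 - θ) * U) := by
      have : θ * (2 * K) = 1 - θ := by linarith
      linear_combination (E - 1) * U * this
    have h3 : (E - 1) * (θ * (S * E) + (1 - θ) * U) ≤ (E - 1) * U := by
      refine mul_le_mul_of_nonneg_left ?_ (by linarith)
      nlinarith
    nlinarith
  nlinarith [mul_le_mul_of_nonneg_right hconv hpos]

theorem exists_nat_rpow_mem_Icc {p X Y : ℝ} (hp : 0 < p) (hX : 0 < X) (hXY : X < Y) :
    ∃ a d : ℕ, 0 < a ∧ 0 < d ∧ (d : ℝ) ^ p * X ≤ (a : ℝ) ^ p ∧ (a : ℝ) ^ p ≤ (d : ℝ) ^ p * Y := by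
  have h1 : 0 < X ^ (1 / p) := Real.rpow_pos_of_pos hX _
  have hY : 0 < Y := hX.trans hXY
  obtain ⟨q, hq1, hq2⟩ := exists_rat_btwn
    (Real.rpow_lt_rpow hX.le hXY (show 0 < 1 / p by positivity))
  have hq0 : 0 < q := by exact_mod_cast h1.trans hq1
  have hd : (0 : ℝ) < q.den := by exact_mod_cast q.den_pos
  have hnum : 0 < q.num := Rat.num_pos.2 hq0
  have ha : ((q.num.toNat : ℕ) : ℝ) = q * q.den := by
    have e1 : ((q.num.toNat : ℤ) : ℝ) = q.num := by rw [Int.toNat_of_nonneg hnum.le]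
    rw [Int.cast_natCast] at e1
    rw [e1]
    exact_mod_cast (Rat.mul_den_eq_num q).symm
  have hqr : (0 : ℝ) < q := by exact_mod_cast hq0
  have e : ∀ W : ℝ, 0 < W → (W ^ (1 / p)) ^ p = W := fun W hW => by
    rw [← Real.rpow_mul hW.le, one_div_mul_cancel hp.ne', Real.rpow_one]
  refine ⟨q.num.toNat, q.den, by omega, q.den_pos, ?_, ?_⟩
  · rw [ha, Real.mul_rpow hqr.le hd.le, mul_comm]
    gcongr
    rw [← e X hX]; gcongr
  · rw [ha, Real.mul_rpow hqr.le hd.le, mul_comm]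
    gcongr
    rw [← e Y hY]; gcongr

theorem le_sum_abs_two_mul_sub_one_rpow {k : ℕ} {p : ℝ} (hp : 0 < p) {x : Fin k → ℤ}
    (hx : ∃ i, x i ≠ 0 ∧ x i ≠ 1) : (3 : ℝ) ^ p - 1 + k ≤ ∑ j, |2 * (x j : ℝ) - 1| ^ p := by
  obtain ⟨i, hi0, hi1⟩ := hx
  have h1 : ∀ j, (1 : ℝ) ≤ |2 * (x j : ℝ) - 1| ^ p := fun j => by
    refine Real.one_le_rpow ?_ hp.le
    have : 1 ≤ |2 * x j - 1| := Int.one_le_abs (by omega)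
    exact_mod_cast this
  have h3 : (3 : ℝ) ^ p ≤ |2 * (x i : ℝ) - 1| ^ p := by
    refine Real.rpow_le_rpow (by norm_num) ?_ hp.le
    have : 3 ≤ |2 * x i - 1| := by rw [le_abs]; omega
    exact_mod_cast this
  rw [← Finset.add_sum_erase _ _ (Finset.mem_univ i)]
  have h4 : ((k : ℝ) - 1) ≤ ∑ j ∈ Finset.univ.erase i, |2 * (x j : ℝ) - 1| ^ p := by
    have := Finset.card_nsmul_le_sum (Finset.univ.erase i) (fun j => |2 * (x j : ℝ) - 1| ^ p) 1
      fun j _ => h1 j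
    rw [Finset.card_erase_of_mem (Finset.mem_univ i), Finset.card_univ, Fintype.card_fin,
      nsmul_eq_mul, mul_one, Nat.cast_sub (by have := i.pos; omega), Nat.cast_one] at this
    exact this
  linarith

theorem exists_parity_isolatingLattice {k : ℕ} (hk : 3 ≤ k) {p : ℝ} (hp : 1 ≤ p)
    (hpk : p < k) (b : Bool) :
    ∃ (ε : ℝ) (d : ℕ) (V : Matrix (Fin d) (Fin k) ℝ) (t : Fin d → ℝ),
      parityGap k p * (1 / (1 + 2 * k / ((3 : ℝ) ^ p - 1))) ≤ ε ∧
      IsIsolatingLattice (ENNReal.ofReal p) (parityConstraint k b) ε V t ∧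
      (IsComputableReal p → HasComputableEntries V t) := by
  have hp0 : 0 < p := by linarith
  have hk0 : (0 : ℝ) < k := by linarith
  have h3 : (0 : ℝ) < 3 ^ p - 1 := by
    have := Real.one_lt_rpow (by norm_num : (1 : ℝ) < 3) hp0
    linarith
  set s := paritySign k p * (-1) ^ b.toNat with hs
  set S := cubeHalfMoment k p (paritySign k p) with hSdef
  set U := cubeHalfMoment k p (-paritySign k p)
  have hS : 0 < S := cubeHalfMoment_pos hk p _
  have hU : 0 < U := cubeHalfMoment_pos hk p _
  have hg0 := parityGap_nonneg k hp0.le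
  have hSU : (1 + parityGap k p) ^ p * S ≤ U :=
    one_add_parityGap_rpow_mul_cubeHalfMoment_le hk hp hpk
  have hE0 : 0 < (1 + parityGap k p) ^ p := Real.rpow_pos_of_pos (by linarith) p
  -- The lower end makes the extra block alone push non-Boolean points far enough; the upper end
  -- limits its cost on Boolean points. The window is nonempty because `(1 + δ) ^ p < 2`.
  obtain ⟨a, d, ha, hd, hlow, hupp⟩ := exists_nat_rpow_mem_Icc hp0
    (X := U / (3 ^ p - 1)) (Y := 2 / (1 + parityGap k p) ^ p * (U / (3 ^ p - 1)))
    (by positivity) (lt_mul_of_one_lt_left (by positivity) (by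
      rw [one_lt_div hE0]; exact one_add_parityGap_rpow_lt_two hp hpk))
  have har : (0 : ℝ) < a := by exact_mod_cast ha
  have hdr : (0 : ℝ) < d := by exact_mod_cast hd
  have hdp : (0 : ℝ) < (d : ℝ) ^ p := Real.rpow_pos_of_pos hdr p
  have hap : (0 : ℝ) < (a : ℝ) ^ p := Real.rpow_pos_of_pos har p
  set T := (d : ℝ) ^ p * S + k * (a : ℝ) ^ p with hT
  set R := (d : ℝ) ^ p * U + k * (a : ℝ) ^ p with hR
  have hT0 : 0 < T := by positivity
  have hR0 : 0 < R := by positivity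
  have hgapR : (1 + parityGap k p * (1 / (1 + 2 * k / (3 ^ p - 1)))) ^ p * T ≤ R := by
    have h := one_add_mul_rpow_mul_add_le (K := k / (3 ^ p - 1))
      (Y := k * (a : ℝ) ^ p / (d : ℝ) ^ p) hp hg0 hS (by positivity) hSU (by
        rw [div_le_iff₀ hdp]
        calc (k : ℝ) * (a : ℝ) ^ p ≤ k * ((d : ℝ) ^ p *
              (2 / (1 + parityGap k p) ^ p * (U / (3 ^ p - 1)))) := by gcongr
          _ = _ := by field_simp)
    rw [← mul_div_assoc 2] at h
    have h' := mul_le_mul_of_nonneg_left h hdp.le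
    have e : ∀ W : ℝ, (d : ℝ) ^ p * (W + k * (a : ℝ) ^ p / (d : ℝ) ^ p) =
        (d : ℝ) ^ p * W + k * (a : ℝ) ^ p := fun W => by field_simp
    rwa [mul_left_comm, e, e] at h'
  set Z := (T ^ (1 / p))⁻¹ with hZ
  have hZ0 : 0 < Z := inv_pos.2 (Real.rpow_pos_of_pos hT0 _)
  set M : Matrix ((Fin k → ℤˣ) ⊕ Fin k) (Fin k) ℤ := Matrix.of (Sum.elim
    (fun u i => d * parityIntMatrix k s u i) fun j i => if i = j then 2 * (a : ℤ) else 0) with hM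
  set τ : (Fin k → ℤˣ) ⊕ Fin k → ℤ :=
    Sum.elim (fun u => d * parityIntTarget k s u) fun _ => a with hτ
  set V := Z • M.map (fun m : ℤ => (m : ℝ)) with hV
  set t := Z • fun u => (τ u : ℝ) with ht
  have hinl : ∀ (z : Fin k → ℝ) u, ∑ i, (M (Sum.inl u) i : ℝ) * z i - τ (Sum.inl u) =
      d * (∑ i, (parityIntMatrix k s u i : ℝ) * z i - parityIntTarget k s u) := fun z u => by
    simp only [hM, hτ, Matrix.of_apply, Sum.elim_inl, Int.cast_mul, Int.cast_natCast, mul_sub,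
      Finset.mul_sum, mul_assoc]
  have hinr : ∀ (z : Fin k → ℝ) j, ∑ i, (M (Sum.inr j) i : ℝ) * z i - τ (Sum.inr j) =
      a * (2 * z j - 1) := fun z j => by
    simp only [hM, hτ, Matrix.of_apply, Sum.elim_inr, Int.cast_natCast, Int.cast_ite, ite_mul,
      Int.cast_zero, zero_mul, Finset.sum_ite_eq', Finset.mem_univ, if_true]
    push_cast; ring
  have hnorm : ∀ z : Fin k → ℝ, lpNorm (ENNReal.ofReal p) (V *ᵥ z - t) =
      Z * ((d : ℝ) ^ p *
        ∑ u, |∑ i, (parityIntMatrix k s u i : ℝ) * z i - parityIntTarget k s u| ^ p +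
        (a : ℝ) ^ p * ∑ j, |2 * z j - 1| ^ p) ^ (1 / p) := fun z => by
    rw [hV, ht, lpNorm_smul_sub hp hZ0.le, Fintype.sum_sum_type]
    simp only [Pi.sub_apply, Matrix.mulVec, dotProduct, Matrix.map_apply, hinl, hinr, abs_mul,
      Nat.abs_cast, Real.mul_rpow (Nat.cast_nonneg _) (abs_nonneg _), Finset.mul_sum]
  have hbool : ∀ x : Fin k → Bool, lpNorm (ENNReal.ofReal p) (V *ᵥ boolVec x - t) =
      Z * (if parityConstraint k b x then T else R) ^ (1 / p) := fun x => by
    have e1 : ∀ j, |2 * boolVec x j - 1| ^ p = 1 := fun j => by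
      rw [boolVec]
      split_ifs <;> norm_num
    rw [hnorm, sum_abs_parityInt_boolVec hp0, hs, paritySign_mul_prod_boolSign]
    simp only [e1, Finset.sum_const, Finset.card_univ, Fintype.card_fin, nsmul_eq_mul, mul_one]
    split_ifs <;> simp only [hT, hR, mul_comm (k : ℝ)] <;> rfl
  have hgap : 1 + parityGap k p * (1 / (1 + 2 * k / (3 ^ p - 1))) ≤ Z * R ^ (1 / p) :=
    one_add_le_inv_mul_rpow hp0 hT0 (by positivity) hgapR
  have hg1 : 0 ≤ parityGap k p * (1 / (1 + 2 * k / ((3 : ℝ) ^ p - 1))) := by positivity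
  have hlat : IsIsolatingLattice (ENNReal.ofReal p) (parityConstraint k b)
      (Z * R ^ (1 / p) - 1) V t := by
    refine ⟨⟨by linarith, ?_, fun x hx => ?_, fun x hx => ?_⟩, fun x hx => ?_⟩
    · refine rank_eq_of_mulVec_injective fun v hv => funext fun j => ?_
      rw [hV, Matrix.smul_mulVec, smul_eq_zero_iff_right hZ0.ne'] at hv
      have h0 : ∑ i, (M (Sum.inr j) i : ℝ) * v i = 0 := congrFun hv (Sum.inr j)
      have h1 := hinr v j
      have h2 : (τ (Sum.inr j) : ℝ) = a := by simp [hτ]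
      rw [h0, h2] at h1
      have : (a : ℝ) * (2 * v j) = 0 := by linarith
      simpa [har.ne'] using this
    · rw [hbool, if_pos hx]
      exact inv_mul_cancel₀ (Real.rpow_pos_of_pos hT0 _).ne'
    · rw [hbool, hx]
      simp
    · rw [hnorm, add_sub_cancel]
      gcongr
      have h1 := le_sum_abs_two_mul_sub_one_rpow hp0 hx
      have h2 : 0 ≤ ∑ u, |∑ i, (parityIntMatrix k s u i : ℝ) * intVec x i -
          parityIntTarget k s u| ^ p := Finset.sum_nonneg fun u _ => by positivity
      -- A coordinate outside `{0, 1}` has `|2x - 1| ≥ 3`; this excess already pays for the whole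
      -- parity block, whose own contribution is discarded.
      have h4 : (d : ℝ) ^ p * U ≤ (a : ℝ) ^ p * (3 ^ p - 1) := by
        rwa [← mul_div_assoc, div_le_iff₀ h3] at hlow
      calc R ≤ (a : ℝ) ^ p * (3 ^ p - 1 + k) := by rw [hR]; linarith
        _ ≤ (a : ℝ) ^ p * ∑ j, |2 * intVec x j - 1| ^ p := by gcongr; exact h1
        _ ≤ _ := le_add_of_nonneg_left (by positivity)
  let e := (Fintype.equivFin ((Fin k → ℤˣ) ⊕ Fin k)).symm
  refine ⟨Z * R ^ (1 / p) - 1, _, V.submatrix e id, t ∘ e, by linarith, hlat.reindex hp e,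
    fun hcp => ?_⟩
  have hcomp : ∀ m : ℤ, IsComputableReal (Z * m) := fun m => by
    have hTsum : T = ∑ j : (Fin k → ℤˣ) ⊕ Fin k, ((Sum.elim
        (fun u => d * cubeFormNat k (paritySign k p) u) (fun _ => a) j : ℕ) : ℝ) ^ p := by
      rw [Fintype.sum_sum_type]
      simp only [Sum.elim_inl, Sum.elim_inr, Nat.cast_mul,
        Real.mul_rpow (Nat.cast_nonneg _) (Nat.cast_nonneg _), cubeFormNat_rpow hp0,
        ← Finset.mul_sum, Finset.sum_const, Finset.card_univ, Fintype.card_fin, nsmul_eq_mul]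
      rfl
    rw [mul_comm, hZ, hTsum]
    exact isComputableReal_intCast_mul_sum_rpow hp hcp
      ⟨Sum.inr ⟨0, by omega⟩, by simpa using ha.ne'⟩ m
  exact ⟨fun u i => hcomp _, fun u => hcomp _⟩

theorem mainTheorem11 (k : ℕ) (hk : 3 ≤ k) (p : ℝ) (hp : 1 ≤ p) (hpk : p < k) (b : Bool) :
    (∃ ε c : ℝ, parityGap k p ≤ ε ∧ 0 < c ∧
      IsIsolatingParallelepiped (ENNReal.ofReal p) (parityConstraint k b) ε
        (c • toBoolMatrix (paramMatrix p (parityWeight k p b)))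
        (c • toBoolTarget (paramMatrix p (parityWeight k p b))
          (paramTarget p (parityWeight k p b) (parityShift k))) ∧
      (IsComputableReal p →
        HasComputableEntries
          (c • toBoolMatrix (paramMatrix p (parityWeight k p b)))
          (c • toBoolTarget (paramMatrix p (parityWeight k p b))
            (paramTarget p (parityWeight k p b) (parityShift k))))) ∧
    (∃ (ε : ℝ) (d : ℕ) (V : Matrix (Fin d) (Fin k) ℝ) (t : Fin d → ℝ),
      parityGap k p * (1 / (1 + 2 * k / ((3 : ℝ) ^ p - 1))) ≤ ε ∧
      parityGap k p / (2 * k) ≤ parityGap k p * (1 / (1 + 2 * k / ((3 : ℝ) ^ p - 1))) ∧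
      IsIsolatingLattice (ENNReal.ofReal p) (parityConstraint k b) ε V t ∧
      (IsComputableReal p → HasComputableEntries V t)) := by
  refine ⟨exists_parity_isolatingParallelepiped hk hp hpk b, ?_⟩
  obtain ⟨ε, d, V, t, hε, hlat, hcomp⟩ := exists_parity_isolatingLattice hk hp hpk b
  refine ⟨ε, d, V, t, hε, ?_, hlat, hcomp⟩
  have hk3 : (3 : ℝ) ≤ k := by exact_mod_cast hk
  have h3 : (2 : ℝ) ≤ 3 ^ p - 1 := by
    have := Real.rpow_le_rpow_of_exponent_le (by norm_num : (1 : ℝ) ≤ 3) hp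
    rw [Real.rpow_one] at this
    linarith
  rw [div_eq_mul_one_div]
  refine mul_le_mul_of_nonneg_left ?_ (parityGap_nonneg k (by linarith))
  refine one_div_le_one_div_of_le (by positivity) ?_
  have : 2 * (k : ℝ) / (3 ^ p - 1) ≤ k := by
    rw [div_le_iff₀ (by linarith)]; nlinarith
  linarith
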